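/- Let $k$ be a commutative ring; algebras are unital associative $k$-algebras. Let $R$ be an algebra and let $(H,s_H,t_H,\Delta,\epsilon)$ be an $R$-bialgebroid. That is, $s_H:R\to H$ and $t_H:R^{op}\to H$ are algebra maps with commuting images; $(H,\Delta,\epsilon)$ is an $R$-coring (a coalgebra in the category of $R$-bimodules) for the bimodule structure $r\cdot h\cdot r'=s_H(r)t_H(r')h$; $\Delta$ corestricts to an algebra map from $H$ to $H\times_R H=\{\sum_i h_i\otimes_R g_i\in H\otimes_RH : \sum_i h_it_H(r)\otimes_R g_i=\sum_i h_i\otimes_R g_is_H(r)\ \forall r\in R\}$ (with componentwise product); $\epsilon(1_H)=1_R$; and $\epsilon(gh)=\epsilon(g\,s_H(\epsilon(h)))=\epsilon(g\,t_H(\epsilon(h)))$ for all $g,h\in H$. Let $(H,A,C)_R$ be a left-left Doi-Koppinen datum over $R$: * $A$ is a left $H$-comodule algebra. That is, $A$ is an algebra with an algebra map $s_A:R\to A$ and a left coaction $\rho:A\to H\otimes_RA$, $\rho(a)=a_{<-1>}\otimes_Ra_{<0>}$, of the $R$-coring $H$ on the left $R$-module $A$ (via $s_A$), such that $\rho$ corestricts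 to an algebra map from $A$ to $H\times_RA=\{\sum_i h_i\otimes_R a_i\in H\otimes_RA : \sum_i h_it_H(r)\otimes_R a_i=\sum_i h_i\otimes_R a_is_A(r)\ \forall r\in R\}$. * $C$ is a left $H$-module coalgebra. That is, $C$ is a left $H$-module and, with $r\cdot c\cdot r'=s_H(r)t_H(r')c$, an $R$-coring $(C,\Delta_C,\epsilon_C)$ such that $\Delta_C(hc)=h_{(1)}c_{(1)}\otimes_Rh_{(2)}c_{(2)}$ and $\epsilon_C(hc)=\epsilon(h\,s_H(\epsilon_C(c)))$ for all $h\in H$, $c\in C$. A Doi-Koppinen module is a left $A$-module $M$ (hence a left $R$-module via $s_A$) with a left coaction $m\mapsto m_{<-1>}\otimes_Rm_{<0>}\in C\otimes_RM$ of the $R$-coring $C$ such that the coaction sends $am$ to $a_{<-1>}m_{<-1>}\otimes_Ra_{<0>}m_{<0>}$ for all $a\in A$, $m\in M$. Morphisms are the $A$-linear $C$-colinear maps, and the resulting category is denoted by ${}^C_A\mathcal M(H;R)$. A functor $F$ is called separable if the natural transformation $\mathrm{Hom}(-,-)\to\mathrm{Hom}(F-,F-)$ that it induces has a natural left inverse.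 Then: (1) The induction functor $G=C\otimes_R-:{}_A\mathcal M\to{}^C_A\mathcal M(H;R)$, where $C\otimes_RM$ has the action $a(c\otimes_Rm)=a_{<-1>}c\otimes_Ra_{<0>}m$ and the coaction $\Delta_C\otimes_RM$, is separable if and only if there exists $e=\sum_ic^i\otimes_Ra^i\in C\otimes_RA$ such that $\sum_is_A(\epsilon_C(c^i))a^i=1_A$ and, for all $a\in A$, $$\sum_ia_{<-1>}c^i\otimes_Ra_{<0>}a^i=\sum_ic^i\otimes_Ra^ia .$$ (2) The forgetful functor $F:{}^C_A\mathcal M(H;R)\to{}_A\mathcal M$ is separable if and only if there exists an $R$-bimodule map $\gamma:C\otimes_RC\to A$ (with $A$ an $R$-bimodule via $s_A$) such that for all $a\in A$ and $c,c'\in C$: * $\gamma(c_{(1)}\otimes_Rc_{(2)})=s_A(\epsilon_C(c))$, * $\gamma(a_{<-2>}c\otimes_Ra_{<-1>}c')\,a_{<0>}=a\,\gamma(c\otimes_Rc')$, where $a_{<-2>}\otimes_Ra_{<-1>}\otimes_Ra_{<0>}=(H\otimes_R\rho)\rho(a)$, * $c_{(1)}\otimes_R\gamma(c_{(2)}\otimes_Rc')=\gamma(c\otimes_Rc'_{(1)})_{<-1>}\,c'_{(2)}\otimes_R\gamma(c\otimes_Rc'_{(1)})_{<0>}$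 in $C\otimes_RA$. -/

import Mathlib

open scoped TensorProduct
open MulOpposite CategoryTheory

universe u

namespace DK

/-! ### Modules, bimodules and tensor products over a noncommutative ring -/

/-- A left action of the ring `R` on the abelian group `M` (a left `R`-module structure). -/
abbrev LAct (R M : Type*) [Ring R] [AddCommGroup M] := R →+* AddMonoid.End M

/-- A right action of the ring `R` on the abelian group `M` (a right `R`-module structure);
`ρ (op r) m` is `m · r`. -/
abbrev RAct (R M : Type*) [Ring R] [AddCommGroup M] := Rᵐᵒᵖ →+* AddMonoid.End M

/-- An `R`-bimodule structure on the abelian group `M`. -/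
structure Bimod (R M : Type*) [Ring R] [AddCommGroup M] where
  l : LAct R M
  r : RAct R M
  comm : ∀ a b m, l a (r b m) = r b (l a m)

/-- Restriction of scalars: the left `R`-action on a left `A`-module along `f : R → A`. -/
abbrev leftVia {R A : Type*} [Ring R] [Ring A] (f : R →+* A) (M : Type*) [AddCommGroup M]
    [Module A M] : LAct R M :=
  (Module.toAddMonoidEnd A M).comp f

section Tensor

variable {R M N P M' N' : Type*} [Ring R] [AddCommGroup M] [AddCommGroup N] [AddCommGroup P]
  [AddCommGroup M'] [AddCommGroup N']

theorem act_zero (l : LAct R M) (m : M) : l 0 m = 0 := by rw [map_zero]; rfl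

theorem act_add (l : LAct R M) (a b : R) (m : M) : l (a + b) m = l a m + l b m := by
  rw [map_add]; rfl

/-- The relations `(m · r) ⊗ n = m ⊗ (r · n)`. -/
def BTensor.rel (ρ : RAct R M) (l : LAct R N) : AddSubgroup (M ⊗[ℤ] N) :=
  AddSubgroup.closure
    {x | ∃ (m : M) (r : R) (n : N), x = (ρ (op r) m) ⊗ₜ[ℤ] n - m ⊗ₜ[ℤ] (l r n)}

/-- The tensor product `M ⊗_R N` of a right `R`-module and a left `R`-module. -/
def BTensor (ρ : RAct R M) (l : LAct R N) := (M ⊗[ℤ] N) ⧸ BTensor.rel ρ l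

namespace BTensor

instance (ρ : RAct R M) (l : LAct R N) : AddCommGroup (BTensor ρ l) :=
  inferInstanceAs (AddCommGroup ((M ⊗[ℤ] N) ⧸ BTensor.rel ρ l))

/-- The canonical biadditive map `(m, n) ↦ m ⊗_R n`. -/
def mk (ρ : RAct R M) (l : LAct R N) : M →+ N →+ BTensor ρ l :=
  AddMonoidHom.mk' (fun m => AddMonoidHom.mk'
    (fun n => (QuotientAddGroup.mk' (BTensor.rel ρ l) (m ⊗ₜ[ℤ] n) : BTensor ρ l))
    (fun a b => by rw [TensorProduct.tmul_add]; exact map_add _ _ _))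
    (fun a b => by
      ext n
      change QuotientAddGroup.mk' (BTensor.rel ρ l) ((a + b) ⊗ₜ[ℤ] n) = _
      rw [TensorProduct.add_tmul]; exact map_add _ _ _)

variable {ρ : RAct R M} {l : LAct R N} {ρ' : RAct R M'} {l' : LAct R N'}

/-- The pure tensor `m ⊗_R n`. -/
abbrev tmul (m : M) (n : N) : BTensor ρ l := mk ρ l m n

theorem tmul_balanced (m : M) (r : R) (n : N) :
    (tmul (ρ (op r) m) n : BTensor ρ l) = tmul m (l r n) := by
  refine sub_eq_zero.mp ?_
  change QuotientAddGroup.mk' (BTensor.rel ρ l) _ - QuotientAddGroup.mk' (BTensor.rel ρ l) _ = 0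
  rw [← map_sub]
  exact (QuotientAddGroup.eq_zero_iff _).mpr (AddSubgroup.subset_closure ⟨m, r, n, rfl⟩)

/-- The universal property of `M ⊗_R N`: a balanced biadditive map induces an additive map. -/
def lift (f : M →+ N →+ P) (hf : ∀ m r n, f (ρ (op r) m) n = f m (l r n)) : BTensor ρ l →+ P :=
  QuotientAddGroup.lift (BTensor.rel ρ l)
    (TensorProduct.liftAddHom f (fun r m n => by simp))
    ((AddSubgroup.closure_le _).mpr (by
      rintro _ ⟨m, r, n, rfl⟩
      change _ = _
      simp [hf]))

@[simp] theorem lift_tmul (f : M →+ N →+ P) (hf : ∀ m r n, f (ρ (op r) m) n = f m (l r n))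
    (m : M) (n : N) : lift f hf (tmul m n : BTensor ρ l) = f m n := rfl

@[elab_as_elim]
theorem ind {p : BTensor ρ l → Prop} (h0 : p 0) (ht : ∀ m n, p (tmul m n))
    (ha : ∀ x y, p x → p y → p (x + y)) (x : BTensor ρ l) : p x := by
  obtain ⟨y, rfl⟩ := QuotientAddGroup.mk'_surjective (BTensor.rel ρ l) x
  induction y using TensorProduct.induction_on with
  | zero => exact h0
  | tmul m n => exact ht m n
  | add x y hx hy => rw [map_add]; exact ha _ _ hx hy

theorem exists_list (x : BTensor ρ l) :
    ∃ L : List (M × N), x = (L.map fun p => (tmul p.1 p.2 : BTensor ρ l)).sum := by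
  induction x using ind with
  | h0 => exact ⟨[], rfl⟩
  | ht m n => exact ⟨[(m, n)], by simp⟩
  | ha x y hx hy =>
    obtain ⟨L, hL⟩ := hx
    obtain ⟨L', hL'⟩ := hy
    exact ⟨L ++ L', by rw [List.map_append, List.sum_append, ← hL, ← hL']⟩

/-- Two additive maps that agree on pure tensors are equal. -/
theorem hom_ext {f g : BTensor ρ l →+ P} (h : ∀ m n, f (tmul m n) = g (tmul m n)) : f = g := by
  ext x
  induction x using ind with
  | h0 => simp
  | ht m n => exact h m n
  | ha x y hx hy => simp [hx, hy]

/-- `f ⊗_R g` for a right `R`-linear map `f` and a left `R`-linear map `g`. -/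
def map (f : M →+ M') (g : N →+ N') (hf : ∀ r m, f (ρ r m) = ρ' r (f m))
    (hg : ∀ r n, g (l r n) = l' r (g n)) : BTensor ρ l →+ BTensor ρ' l' :=
  lift (((mk ρ' l').comp f).compl₂ g) (fun m r n => by
    simpa [hf, hg] using tmul_balanced _ _ _)

@[simp] theorem map_tmul (f : M →+ M') (g : N →+ N') (hf : ∀ r m, f (ρ r m) = ρ' r (f m))
    (hg : ∀ r n, g (l r n) = l' r (g n)) (m : M) (n : N) :
    map f g hf hg (tmul m n : BTensor ρ l) = tmul (f m) (g n) := rfl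

end BTensor

open BTensor

/-- The left `R`-action `r · (m ⊗ n) = (r · m) ⊗ n` on `M ⊗_R N`, for a bimodule `M`. -/
def Bimod.tensorLeft (B : Bimod R M) (l : LAct R N) : LAct R (BTensor B.r l) where
  toFun r := BTensor.map (B.l r) (AddMonoidHom.id N) (fun b m => B.comm r b m) (fun _ _ => rfl)
  map_one' := hom_ext (fun m n => by
    change tmul (B.l 1 m) n = tmul m n
    rw [map_one]; rfl)
  map_zero' := hom_ext (fun m n => by
    change tmul (B.l 0 m) n = 0
    rw [act_zero, tmul, map_zero]; rfl)
  map_mul' a b := hom_ext (fun m n => by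
    change tmul (B.l (a * b) m) n = tmul (B.l a (B.l b m)) n
    rw [map_mul]; rfl)
  map_add' a b := hom_ext (fun m n => by
    change tmul (B.l (a + b) m) n = tmul (B.l a m) n + tmul (B.l b m) n
    rw [act_add, tmul, map_add]; rfl)

/-- The right `R`-action `(m ⊗ n) · r = m ⊗ (n · r)` on `M ⊗_R N`, for a bimodule `N`. -/
def Bimod.tensorRight (ρ : RAct R M) (B : Bimod R N) : RAct R (BTensor ρ B.l) where
  toFun r := BTensor.map (AddMonoidHom.id M) (B.r r) (fun _ _ => rfl)
    (fun a n => (B.comm a r n).symm)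
  map_one' := hom_ext (fun m n => by
    change tmul m (B.r 1 n) = tmul m n
    rw [map_one]; rfl)
  map_zero' := hom_ext (fun m n => by
    change tmul m (B.r 0 n) = 0
    rw [act_zero, tmul, map_zero])
  map_mul' a b := hom_ext (fun m n => by
    change tmul m (B.r (a * b) n) = tmul m (B.r a (B.r b n))
    rw [map_mul]; rfl)
  map_add' a b := hom_ext (fun m n => by
    change tmul m (B.r (a + b) n) = tmul m (B.r a n) + tmul m (B.r b n)
    rw [act_add, tmul, map_add])

@[simp] theorem Bimod.tensorLeft_tmul (B : Bimod R M) (l : LAct R N) (r : R) (m : M) (n : N) :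
    B.tensorLeft l r (tmul m n) = tmul (B.l r m) n := rfl

@[simp] theorem Bimod.tensorRight_tmul (ρ : RAct R M) (B : Bimod R N) (r : Rᵐᵒᵖ) (m : M) (n : N) :
    Bimod.tensorRight ρ B r (tmul m n) = tmul m (B.r r n) := rfl

/-- The tensor product of two bimodules is a bimodule. -/
abbrev Bimod.tensor (B : Bimod R M) (B' : Bimod R N) : Bimod R (BTensor B.r B'.l) where
  l := B.tensorLeft B'.l
  r := Bimod.tensorRight B.r B'
  comm a b x := by
    induction x using BTensor.ind with
    | h0 => simp
    | ht m n => simp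
    | ha x y hx hy => simp [hx, hy]

/-- The associativity map `(M ⊗_R N) ⊗_R P → M ⊗_R (N ⊗_R P)`,
`(m ⊗ n) ⊗ p ↦ m ⊗ (n ⊗ p)`. -/
def assoc (ρ : RAct R M) (B : Bimod R N) (l : LAct R P) :
    BTensor (Bimod.tensorRight ρ B) l →+ BTensor ρ (B.tensorLeft l) :=
  lift (AddMonoidHom.flip (AddMonoidHom.mk'
    (fun p => BTensor.map (AddMonoidHom.id M) ((mk B.r l).flip p) (fun _ _ => rfl)
      (fun _ _ => rfl))
    (fun p q => hom_ext (fun m n => by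
      change tmul m (tmul n (p + q)) = tmul m (tmul n p) + tmul m (tmul n q)
      simp only [map_add]))))
    (fun x r p => by
      induction x using BTensor.ind with
      | h0 => simp
      | ht m n =>
        change tmul m (tmul (B.r (op r) n) p) = tmul m (tmul n (l r p))
        rw [tmul_balanced]
      | ha x y hx hy => simp only [map_add, AddMonoidHom.add_apply, hx, hy])

@[simp] theorem assoc_tmul (ρ : RAct R M) (B : Bimod R N) (l : LAct R P) (m : M) (n : N) (p : P) :
    assoc ρ B l (tmul (tmul m n) p) = tmul m (tmul n p) := rfl

/-- A map of `R`-bimodules. -/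
structure BimodHom (B : Bimod R M) (B' : Bimod R N) where
  toHom : M →+ N
  map_left : ∀ r m, toHom (B.l r m) = B'.l r (toHom m)
  map_right : ∀ r m, toHom (B.r r m) = B'.r r (toHom m)

end Tensor

/-- A ring homomorphism `f : R → A` makes `A` an `R`-bimodule, `r · a · r' = f r * a * f r'`. -/
def ringBimod {R A : Type*} [Ring R] [Ring A] (f : R →+* A) : Bimod R A where
  l := leftVia f A
  r := (Module.toAddMonoidEnd Aᵐᵒᵖ A).comp f.op
  comm a b m := (mul_assoc (f a) m (f b.unop)).symm

/-! ### Corings and comodules -/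

section Coring

variable {R C M : Type*} [Ring R] [AddCommGroup C] [AddCommGroup M]

/-- For a right `R`-linear map `ε : C → R` and a left `R`-module `M`, the map
`C ⊗_R M → R ⊗_R M ≅ M`, `c ⊗ m ↦ ε(c) · m`. -/
def contractLeft {ρ : RAct R C} (ε : C →+ R) (hε : ∀ r c, ε (ρ (op r) c) = ε c * r)
    (l : LAct R M) : BTensor ρ l →+ M :=
  BTensor.lift (l.toAddMonoidHom.comp ε) (fun c r m => by
    change l (ε (ρ (op r) c)) m = l (ε c) (l r m)
    rw [hε, map_mul]; rfl)

/-- For a left `R`-linear map `ε : C → R` and a right `R`-module `M`, the map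
`M ⊗_R C → M ⊗_R R ≅ M`, `m ⊗ c ↦ m · ε(c)`. -/
def contractRight {l : LAct R C} (ε : C →+ R) (hε : ∀ r c, ε (l r c) = r * ε c)
    (ρ : RAct R M) : BTensor ρ l →+ M :=
  BTensor.lift (AddMonoidHom.flip
      ((ρ.toAddMonoidHom.comp (opAddEquiv : R ≃+ Rᵐᵒᵖ).toAddMonoidHom).comp ε))
    (fun m r c => by
      change ρ (op (ε c)) (ρ (op r) m) = ρ (op (ε (l r c))) m
      rw [hε, op_mul, map_mul]; rfl)

/-- An `R`-coring structure on the `R`-bimodule `C`: a coalgebra in the monoidal category of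
`R`-bimodules. -/
structure Coring (B : Bimod R C) where
  comul : BimodHom B (B.tensor B)
  counit : BimodHom B (ringBimod (RingHom.id R))
  coassoc : ∀ c, assoc B.r B B.l
      (BTensor.map comul.toHom (AddMonoidHom.id C) comul.map_right (fun _ _ => rfl)
        (comul.toHom c)) =
    BTensor.map (AddMonoidHom.id C) comul.toHom (fun _ _ => rfl) comul.map_left (comul.toHom c)
  counit_comul : ∀ c,
    contractLeft counit.toHom (fun r => counit.map_right (op r)) B.l (comul.toHom c) = c
  comul_counit : ∀ c, contractRight counit.toHom counit.map_left B.r (comul.toHom c) = c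

/-- The structure of a left comodule of the `R`-coring `C` on the left `R`-module `M`. -/
structure LeftComodule {B : Bimod R C} (K : Coring B) (l : LAct R M) where
  coact : M →+ BTensor B.r l
  coact_left : ∀ r m, coact (l r m) = B.tensorLeft l r (coact m)
  coassoc : ∀ m, BTensor.map (AddMonoidHom.id C) coact (fun _ _ => rfl) coact_left (coact m) =
    assoc B.r B l
      (BTensor.map K.comul.toHom (AddMonoidHom.id M) K.comul.map_right (fun _ _ => rfl) (coact m))
  counit_coact : ∀ m,
    contractLeft K.counit.toHom (fun r => K.counit.map_right (op r)) l (coact m) = m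

end Coring

/-! ### Bialgebroids -/

section Bialgebroid

/-- An `R^e`-ring structure on `H`, `R^e = R ⊗ R^op`: the source and target maps. -/
structure EnvRing (k R H : Type*) [CommRing k] [Ring R] [Algebra k R] [Ring H] [Algebra k H] where
  s : R →ₐ[k] H
  t : Rᵐᵒᵖ →ₐ[k] H
  comm : ∀ a b, s a * t b = t b * s a

variable {k R H A : Type*} [CommRing k] [Ring R] [Algebra k R] [Ring H] [Algebra k H] [Ring A]

/-- The `R`-bimodule underlying a left `H`-module `X`: `r · x · r' = s(r) t(r') x`. For `X = H` this
is the `R`-bimodule structure of `H`. -/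
abbrev EnvRing.bimod (E : EnvRing k R H) (X : Type*) [AddCommGroup X] [Module H X] :
    Bimod R X where
  l := leftVia (E.s : R →+* H) X
  r := leftVia (E.t : Rᵐᵒᵖ →+* H) X
  comm a b x := by
    change E.s a • E.t b • x = E.t b • E.s a • x
    rw [smul_smul, smul_smul, E.comm]

/-- The tensor product `X ⊗_R N` of a left `H`-module `X` (a right `R`-module through the target
map) and a left `A`-module `N` (a left `R`-module through `f : R → A`). -/
abbrev EnvRing.Tens (E : EnvRing k R H) (f : R →+* A) (X N : Type*) [AddCommGroup X] [Module H X]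
    [AddCommGroup N] [Module A N] :=
  BTensor (E.bimod X).r (leftVia f N)

variable (E : EnvRing k R H) (f : R →+* A) {X N : Type*} [AddCommGroup X] [Module H X]
  [AddCommGroup N] [Module A N]

/-- The map `H ⊗_R A → H ⊗_R A`, `h ⊗ a ↦ h t(r) ⊗ a`. -/
def EnvRing.mulT (r : R) : E.Tens f H A →+ E.Tens f H A :=
  BTensor.map (AddMonoidHom.mulRight (E.t (op r))) (AddMonoidHom.id A)
    (fun a h => mul_assoc (E.t a) h _) (fun _ _ => rfl)

/-- The map `H ⊗_R A → H ⊗_R A`, `h ⊗ a ↦ h ⊗ a f(r)`. -/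
def EnvRing.mulS (r : R) : E.Tens f H A →+ E.Tens f H A :=
  BTensor.map (AddMonoidHom.id H) (AddMonoidHom.mulRight (f r)) (fun _ _ => rfl)
    (fun b a => mul_assoc (f b) a _)

/-- The Takeuchi product `H ×_R A`, that is, all `∑ hᵢ ⊗ aᵢ` in `H ⊗_R A` with
`∑ hᵢ t(r) ⊗ aᵢ = ∑ hᵢ ⊗ aᵢ f(r)` for all `r`. -/
def EnvRing.takeuchi : AddSubgroup (E.Tens f H A) :=
  ⨅ r : R, AddMonoidHom.eqLocus (E.mulT f r) (E.mulS f r)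

/-- For `x : X` and `n : N`, the map `H ⊗_R A → X ⊗_R N`, `h ⊗ a ↦ h x ⊗ a n`. -/
def EnvRing.orbit (x : X) (n : N) : E.Tens f H A →+ E.Tens f X N :=
  BTensor.map (AddMonoidHom.smul.flip x) (AddMonoidHom.smul.flip n)
    (fun r h => mul_smul (E.t r) h x) (fun r a => mul_smul (f r) a n)

@[simp] theorem EnvRing.orbit_tmul (x : X) (n : N) (h : H) (a : A) :
    E.orbit f x n (BTensor.tmul h a) = BTensor.tmul (h • x) (a • n) := rfl

theorem EnvRing.orbit_mulT (x : X) (n : N) (r : R) (u : E.Tens f H A) :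
    E.orbit f x n (E.mulT f r u) = E.orbit f (E.t (op r) • x) n u := by
  induction u using BTensor.ind with
  | h0 => simp
  | ht h a =>
    change BTensor.tmul ((h * E.t (op r)) • x) (a • n) = BTensor.tmul (h • E.t (op r) • x) (a • n)
    rw [mul_smul]
  | ha u v hu hv => simp [hu, hv]

theorem EnvRing.orbit_mulS (x : X) (n : N) (r : R) (u : E.Tens f H A) :
    E.orbit f x n (E.mulS f r u) = E.orbit f x (f r • n) u := by
  induction u using BTensor.ind with
  | h0 => simp
  | ht h a =>
    change BTensor.tmul (h • x) ((a * f r) • n) = BTensor.tmul (h • x) (a • f r • n)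
    rw [mul_smul]
  | ha u v hu hv => simp [hu, hv]

theorem EnvRing.orbit_add_left (x y : X) (n : N) (u : E.Tens f H A) :
    E.orbit f (x + y) n u = E.orbit f x n u + E.orbit f y n u := by
  induction u using BTensor.ind with
  | h0 => simp
  | ht h a =>
    change BTensor.mk _ _ (h • (x + y)) (a • n) =
      BTensor.mk _ _ (h • x) (a • n) + BTensor.mk _ _ (h • y) (a • n)
    rw [smul_add, map_add]; rfl
  | ha u v hu hv => rw [map_add, map_add, map_add, hu, hv]; abel

theorem EnvRing.orbit_add_right (x : X) (n p : N) (u : E.Tens f H A) :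
    E.orbit f x (n + p) u = E.orbit f x n u + E.orbit f x p u := by
  induction u using BTensor.ind with
  | h0 => simp
  | ht h a =>
    change BTensor.mk _ _ (h • x) (a • (n + p)) =
      BTensor.mk _ _ (h • x) (a • n) + BTensor.mk _ _ (h • x) (a • p)
    rw [smul_add, map_add]
  | ha u v hu hv => rw [map_add, map_add, map_add, hu, hv]; abel

/-- The action of `H ×_R A` on `X ⊗_R N`, `(∑ hᵢ ⊗ aᵢ) · (x ⊗ n) = ∑ hᵢ x ⊗ aᵢ n`. For `X = H` and
`N = A` this is multiplication by an element of `H ×_R A`. -/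
def EnvRing.act (u : E.takeuchi f) : E.Tens f X N →+ E.Tens f X N :=
  BTensor.lift (AddMonoidHom.mk' (fun x => AddMonoidHom.mk' (fun n => E.orbit f x n u)
      (fun n p => E.orbit_add_right f x n p u))
      (fun x y => AddMonoidHom.ext fun n => E.orbit_add_left f x y n u))
    (fun x r n => by
      change E.orbit f (E.t (op r) • x) n u = E.orbit f x (f r • n) u
      rw [← E.orbit_mulT, ← E.orbit_mulS, (AddSubgroup.mem_iInf.mp u.2 r : _ = _)])

@[simp] theorem EnvRing.act_tmul (u : E.takeuchi f) (x : X) (n : N) :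
    E.act f u (BTensor.tmul x n) = E.orbit f x n u := rfl

/-- An `R`-bialgebroid structure on `H`. -/
structure Bialgebroid (k R H : Type*) [CommRing k] [Ring R] [Algebra k R] [Ring H] [Algebra k H]
    extends EnvRing k R H where
  coring : Coring (toEnvRing.bimod H)
  comul_mem : ∀ h, coring.comul.toHom h ∈ toEnvRing.takeuchi (s : R →+* H)
  comul_one : coring.comul.toHom 1 = BTensor.tmul 1 1
  comul_mul : ∀ g h, coring.comul.toHom (g * h) =
    toEnvRing.act (s : R →+* H) ⟨coring.comul.toHom g, comul_mem g⟩ (coring.comul.toHom h)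
  counit_one : coring.counit.toHom 1 = 1
  counit_mul_s : ∀ g h,
    coring.counit.toHom (g * h) = coring.counit.toHom (g * s (coring.counit.toHom h))
  counit_mul_t : ∀ g h,
    coring.counit.toHom (g * h) = coring.counit.toHom (g * t (op (coring.counit.toHom h)))

/-- The coproduct of a bialgebroid, as an element of `H ×_R H`. -/
def Bialgebroid.Δ (B : Bialgebroid k R H) (h : H) : B.takeuchi (B.s : R →+* H) :=
  ⟨B.coring.comul.toHom h, B.comul_mem h⟩

/-- A left `H`-module coalgebra structure on the left `H`-module `C`: an `R`-coring structure whose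
coproduct and counit are `H`-linear, where `h · (x ⊗ y) = h₍₁₎ x ⊗ h₍₂₎ y` on `C ⊗_R C` and
`h ▹ r = ε(h s(r))` on `R`. -/
structure ModuleCoalgebra (B : Bialgebroid k R H) (C : Type*) [AddCommGroup C] [Module H C] where
  coring : Coring (B.bimod C)
  comul_smul : ∀ (h : H) (c : C),
    coring.comul.toHom (h • c) = B.act (B.s : R →+* H) (B.Δ h) (coring.comul.toHom c)
  counit_smul : ∀ (h : H) (c : C),
    coring.counit.toHom (h • c) = B.coring.counit.toHom (h * B.s (coring.counit.toHom c))

/-- A left `H`-comodule algebra structure on the `k`-algebra `A`: an `R`-ring structure `s` and a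
left coaction of the coring `H` which corestricts to an algebra map `A → H ×_R A`. -/
structure ComoduleAlgebra (B : Bialgebroid k R H) (A : Type*) [Ring A] [Algebra k A] where
  s : R →ₐ[k] A
  comodule : LeftComodule B.coring (leftVia (s : R →+* A) A)
  coact_mem : ∀ a, comodule.coact a ∈ B.takeuchi (s : R →+* A)
  coact_one : comodule.coact 1 = BTensor.tmul 1 1
  coact_mul : ∀ a b, comodule.coact (a * b) =
    B.act (s : R →+* A) ⟨comodule.coact a, coact_mem a⟩ (comodule.coact b)

/-- A left-left Doi-Koppinen datum `(H, A, C)_R`. -/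
structure Datum (k R H A C : Type*) [CommRing k] [Ring R] [Algebra k R] [Ring H] [Algebra k H]
    [Ring A] [Algebra k A] [AddCommGroup C] [Module H C] where
  bialg : Bialgebroid k R H
  alg : ComoduleAlgebra bialg A
  coalg : ModuleCoalgebra bialg C

end Bialgebroid

/-! ### Doi-Koppinen modules -/

section Modules

variable {k R H : Type*} {A C : Type u} [CommRing k] [Ring R] [Algebra k R] [Ring H] [Algebra k H]
  [Ring A] [Algebra k A] [AddCommGroup C] [Module H C] (D : Datum k R H A C)

namespace Datum

/-- The `R`-ring structure map `R → A`. -/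
abbrev sA : R →+* A := D.alg.s

/-- The coaction `a ↦ a₍₋₁₎ ⊗ a₍₀₎` of `H` on `A`, with values in `H ×_R A`. -/
def coactA (a : A) : D.bialg.takeuchi D.sA := ⟨D.alg.comodule.coact a, D.alg.coact_mem a⟩

/-- `C ⊗_R M` for a left `A`-module `M`. -/
abbrev Ind (M : Type*) [AddCommGroup M] [Module A M] := D.bialg.Tens D.sA C M

/-- The left `A`-action on `C ⊗_R M`, `a · (c ⊗ m) = a₍₋₁₎ c ⊗ a₍₀₎ m`. -/
def actInd {M : Type*} [AddCommGroup M] [Module A M] (a : A) : D.Ind M →+ D.Ind M :=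
  D.bialg.act D.sA (D.coactA a)

end Datum

/-- A left-left Doi-Koppinen module. -/
structure DKModule where
  carrier : Type u
  [addCommGroup : AddCommGroup carrier]
  [module : Module A carrier]
  comodule : LeftComodule D.coalg.coring (leftVia D.sA carrier)
  compat : ∀ (a : A) (m : carrier), comodule.coact (a • m) = D.actInd a (comodule.coact m)

attribute [instance] DKModule.addCommGroup DKModule.module

namespace DKModule

variable {D}

/-- `C ⊗_R f : C ⊗_R M → C ⊗_R N` for an `A`-linear map `f : M → N`. -/
def indMap {M N : Type*} [AddCommGroup M] [Module A M] [AddCommGroup N] [Module A N]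
    (f : M →ₗ[A] N) : D.Ind M →+ D.Ind N :=
  BTensor.map (AddMonoidHom.id C) f.toAddMonoidHom (fun _ _ => rfl)
    (fun r m => f.map_smul (D.sA r) m)

@[simp] theorem indMap_tmul {M N : Type*} [AddCommGroup M] [Module A M] [AddCommGroup N]
    [Module A N] (f : M →ₗ[A] N) (c : C) (m : M) :
    (indMap f : D.Ind M →+ D.Ind N) (BTensor.tmul c m) = BTensor.tmul c (f m) := rfl

/-- A morphism of Doi-Koppinen modules: an `A`-linear and `C`-colinear map. -/
@[ext]
structure Hom (M N : DKModule D) where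
  lin : M.carrier →ₗ[A] N.carrier
  colin : ∀ m, N.comodule.coact (lin m) = indMap lin (M.comodule.coact m)

theorem indMap_id {M : Type*} [AddCommGroup M] [Module A M] (x : D.Ind M) :
    (indMap (LinearMap.id : M →ₗ[A] M) : D.Ind M →+ D.Ind M) x = x := by
  induction x using BTensor.ind with
  | h0 => simp
  | ht c m => rfl
  | ha x y hx hy => rw [map_add, hx, hy]

theorem indMap_comp {M N P : Type*} [AddCommGroup M] [Module A M] [AddCommGroup N] [Module A N]
    [AddCommGroup P] [Module A P] (g : N →ₗ[A] P) (f : M →ₗ[A] N) (x : D.Ind M) :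
    (indMap (g.comp f) : D.Ind M →+ D.Ind P) x = indMap g (indMap f x : D.Ind N) := by
  induction x using BTensor.ind with
  | h0 => simp
  | ht c m => rfl
  | ha x y hx hy => simp only [map_add, hx, hy]

/-- The category of Doi-Koppinen modules. -/
instance : Category (DKModule D) where
  Hom M N := Hom M N
  id M := ⟨LinearMap.id, fun m => (indMap_id _).symm⟩
  comp f g := ⟨g.lin.comp f.lin, fun m => by
    rw [indMap_comp, ← f.colin, ← g.colin]; rfl⟩

end DKModule

namespace Datum

open DKModule

/-- The forgetful functor from Doi-Koppinen modules to left `A`-modules. -/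
def forget : DKModule D ⥤ ModuleCat.{u} A where
  obj M := ModuleCat.of A M.carrier
  map f := ModuleCat.ofHom f.lin

theorem coactA_one : (D.coactA 1 : D.bialg.Tens D.sA H A) = BTensor.tmul 1 1 := D.alg.coact_one

theorem coactA_add (a b : A) : (D.coactA (a + b) : D.bialg.Tens D.sA H A) =
    (D.coactA a : D.bialg.Tens D.sA H A) + (D.coactA b : D.bialg.Tens D.sA H A) :=
  map_add D.alg.comodule.coact a b

theorem coactA_mul (a b : A) : (D.coactA (a * b) : D.bialg.Tens D.sA H A) =
    D.bialg.act D.sA (D.coactA a) (D.coactA b : D.bialg.Tens D.sA H A) := D.alg.coact_mul a b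

theorem coactA_sA (r : R) :
    (D.coactA (D.sA r) : D.bialg.Tens D.sA H A) = BTensor.tmul (D.bialg.s r) 1 := by
  have h := D.alg.comodule.coact_left r 1
  rw [D.alg.coact_one] at h
  have h1 : leftVia D.sA A r 1 = D.sA r := mul_one _
  rw [h1] at h
  refine h.trans ?_
  change BTensor.tmul (D.bialg.s r * 1) 1 = _
  rw [mul_one]

section Ind

variable {M : Type*} [AddCommGroup M] [Module A M]

theorem orbit_orbit (x : C) (m : M) (h : H) (a : A) (u : D.bialg.Tens D.sA H A) :
    D.bialg.orbit D.sA x m (D.bialg.orbit D.sA h a u) = D.bialg.orbit D.sA (h • x) (a • m) u := by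
  induction u using BTensor.ind with
  | h0 => simp
  | ht g b =>
    change BTensor.tmul ((g * h) • x) ((b * a) • m) = BTensor.tmul (g • h • x) (b • a • m)
    rw [mul_smul, mul_smul]
  | ha u v hu hv => simp only [map_add, hu, hv]

theorem orbit_act (x : C) (m : M) (u : D.bialg.takeuchi D.sA) (v : D.bialg.Tens D.sA H A) :
    D.bialg.orbit D.sA x m (D.bialg.act D.sA u v) =
      D.bialg.act D.sA u (D.bialg.orbit D.sA x m v) := by
  induction v using BTensor.ind with
  | h0 => simp
  | ht h a => exact D.orbit_orbit x m h a u
  | ha u v hu hv => simp only [map_add, hu, hv]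

/-- The left `A`-module `C ⊗_R M`. -/
instance indModule : Module A (D.Ind M) where
  smul a x := D.actInd a x
  one_smul x := by
    change D.actInd 1 x = x
    induction x using BTensor.ind with
    | h0 => simp
    | ht c m =>
      change D.bialg.orbit D.sA c m (D.coactA 1) = _
      rw [coactA_one]
      change BTensor.tmul ((1 : H) • c) ((1 : A) • m) = _
      rw [one_smul, one_smul]
    | ha x y hx hy => rw [map_add, hx, hy]
  mul_smul a b x := by
    change D.actInd (a * b) x = D.actInd a (D.actInd b x)
    induction x using BTensor.ind with
    | h0 => simp
    | ht c m =>
      change D.bialg.orbit D.sA c m (D.coactA (a * b)) = _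
      rw [coactA_mul]
      exact D.orbit_act c m _ _
    | ha x y hx hy => simp only [map_add, hx, hy]
  smul_zero a := map_zero (D.actInd a)
  smul_add a := map_add (D.actInd a)
  add_smul a b x := by
    change D.actInd (a + b) x = D.actInd a x + D.actInd b x
    induction x using BTensor.ind with
    | h0 => simp
    | ht c m =>
      change D.bialg.orbit D.sA c m (D.coactA (a + b)) = _
      rw [coactA_add, map_add]; rfl
    | ha x y hx hy => rw [map_add, map_add, map_add, hx, hy]; abel
  zero_smul x := by
    change D.actInd 0 x = 0
    induction x using BTensor.ind with
    | h0 => simp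
    | ht c m =>
      change D.bialg.orbit D.sA c m (D.alg.comodule.coact 0) = _
      rw [map_zero, map_zero]
    | ha x y hx hy => rw [map_add, hx, hy, add_zero]

theorem smul_tmul (a : A) (c : C) (m : M) :
    a • (BTensor.tmul c m : D.Ind M) = D.bialg.orbit D.sA c m (D.coactA a) := rfl

/-- The left `R`-action on `C ⊗_R M` through `A` is `r · (c ⊗ m) = (r · c) ⊗ m`. -/
theorem leftVia_ind (r : R) (x : D.Ind M) :
    leftVia D.sA (D.Ind M) r x = (D.bialg.bimod C).tensorLeft (leftVia D.sA M) r x := by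
  change D.actInd (D.sA r) x = _
  induction x using BTensor.ind with
  | h0 => simp
  | ht c m =>
    change D.bialg.orbit D.sA c m (D.coactA (D.sA r)) = _
    rw [coactA_sA]
    change BTensor.tmul (D.bialg.s r • c) ((1 : A) • m) = _
    rw [one_smul]; rfl
  | ha x y hx hy => rw [map_add, map_add, hx, hy]

/-- The associativity map `(C ⊗_R C) ⊗_R M → C ⊗_R (C ⊗_R M)`. -/
def assocInd :
    BTensor ((D.bialg.bimod C).tensor (D.bialg.bimod C)).r (leftVia D.sA M) →+
      D.Ind (D.Ind M) :=
  (BTensor.map (AddMonoidHom.id C) (AddMonoidHom.id (D.Ind M)) (fun _ _ => rfl)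
    (fun r x => (D.leftVia_ind r x).symm)).comp
    (assoc (D.bialg.bimod C).r (D.bialg.bimod C) (leftVia D.sA M))

/-- The coaction `Δ ⊗_R M` of `C` on `C ⊗_R M`. -/
def coactInd : D.Ind M →+ D.Ind (D.Ind M) :=
  D.assocInd.comp
    (BTensor.map D.coalg.coring.comul.toHom (AddMonoidHom.id M) D.coalg.coring.comul.map_right
      (fun _ _ => rfl))

/-- For `m : M`, the map `C ⊗_R C → C ⊗_R (C ⊗_R M)`, `x ⊗ y ↦ x ⊗ (y ⊗ m)`. -/
def insInd (m : M) :
    BTensor (D.bialg.bimod C).r (D.bialg.bimod C).l →+ D.Ind (D.Ind M) :=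
  BTensor.map (AddMonoidHom.id C) ((BTensor.mk _ _).flip m) (fun _ _ => rfl)
    (fun r y => (D.leftVia_ind r (BTensor.tmul y m)).symm)

theorem coactInd_tmul (c : C) (m : M) :
    D.coactInd (BTensor.tmul c m : D.Ind M) = D.insInd m (D.coalg.coring.comul.toHom c) := by
  change D.assocInd (BTensor.tmul (D.coalg.coring.comul.toHom c) m) = _
  generalize D.coalg.coring.comul.toHom c = v
  change D.assocInd (BTensor.mk _ _ v m) = _
  induction v using BTensor.ind with
  | h0 => rw [map_zero, map_zero]; exact map_zero D.assocInd
  | ht x y => rfl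
  | ha v w hv hw =>
    rw [map_add, map_add, ← hv, ← hw]
    exact map_add D.assocInd _ _

theorem insInd_left (m : M) (r : R)
    (v : BTensor (D.bialg.bimod C).r (D.bialg.bimod C).l) :
    D.insInd m (((D.bialg.bimod C).tensor (D.bialg.bimod C)).l r v) =
      (D.bialg.bimod C).tensorLeft (leftVia D.sA (D.Ind M)) r (D.insInd m v) := by
  induction v using BTensor.ind with
  | h0 => simp only [map_zero]
  | ht x y => rfl
  | ha v w hv hw => simp only [map_add, hv, hw]

theorem coactInd_left (r : R) (x : D.Ind M) :
    D.coactInd (leftVia D.sA (D.Ind M) r x) =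
      (D.bialg.bimod C).tensorLeft (leftVia D.sA (D.Ind M)) r (D.coactInd x) := by
  rw [leftVia_ind]
  induction x using BTensor.ind with
  | h0 => simp only [map_zero]
  | ht c m =>
    change D.coactInd (BTensor.tmul ((D.bialg.bimod C).l r c) m) = _
    rw [coactInd_tmul, coactInd_tmul, D.coalg.coring.comul.map_left, insInd_left]
  | ha x y hx hy => simp only [map_add, hx, hy]

theorem coactInd_counit (x : D.Ind M) :
    contractLeft D.coalg.coring.counit.toHom
      (fun r => D.coalg.coring.counit.map_right (op r)) (leftVia D.sA (D.Ind M))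
      (D.coactInd x) = x := by
  induction x using BTensor.ind with
  | h0 => simp only [map_zero]
  | ht c m =>
    rw [coactInd_tmul]
    refine Eq.trans ?_
      (congrArg (fun y => BTensor.mk _ _ y m) (D.coalg.coring.counit_comul c))
    generalize D.coalg.coring.comul.toHom c = v
    induction v using BTensor.ind with
    | h0 => simp only [map_zero]; rfl
    | ht x y => exact D.leftVia_ind _ (BTensor.tmul y m)
    | ha v w hv hw => simp only [map_add, hv, hw]; rfl
  | ha x y hx hy => simp only [map_add, hx, hy]

theorem coactInd_coassoc (x : D.Ind M) :
    BTensor.map (AddMonoidHom.id C) D.coactInd (fun _ _ => rfl) D.coactInd_left (D.coactInd x) =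
    assoc (D.bialg.bimod C).r (D.bialg.bimod C) (leftVia D.sA (D.Ind M))
      (BTensor.map D.coalg.coring.comul.toHom (AddMonoidHom.id (D.Ind M))
        D.coalg.coring.comul.map_right (fun _ _ => rfl) (D.coactInd x)) := by
  induction x using BTensor.ind with
  | h0 => simp only [map_zero]
  | ht c m =>
    rw [coactInd_tmul]
    have key := congrArg (BTensor.map (ρ' := (D.bialg.bimod C).r)
      (l' := (D.bialg.bimod C).tensorLeft (leftVia D.sA (D.Ind M)))
      (AddMonoidHom.id C) (D.insInd m) (fun _ _ => rfl) (D.insInd_left m))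
      (D.coalg.coring.coassoc c)
    refine Eq.trans ?_ (key.symm.trans ?_)
    · clear key
      generalize D.coalg.coring.comul.toHom c = v
      induction v using BTensor.ind with
      | h0 => simp only [map_zero]
      | ht x y =>
        change BTensor.tmul x (D.coactInd (BTensor.tmul y m)) = _
        rw [coactInd_tmul]; rfl
      | ha v w hv hw => simp only [map_add, hv, hw]
    · clear key
      generalize D.coalg.coring.comul.toHom c = v
      induction v using BTensor.ind with
      | h0 => simp only [map_zero]
      | ht x y =>
        change BTensor.map _ _ _ _ (assoc _ _ _ (BTensor.mk _ _ (D.coalg.coring.comul.toHom x) y))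
          = assoc _ _ _ (BTensor.mk _ _ (D.coalg.coring.comul.toHom x) (BTensor.tmul y m))
        generalize D.coalg.coring.comul.toHom x = w
        induction w using BTensor.ind with
        | h0 => simp only [map_zero, AddMonoidHom.zero_apply]
        | ht p q => rfl
        | ha v w hv hw => simp only [map_add, AddMonoidHom.add_apply, hv, hw]
      | ha v w hv hw => simp only [map_add, hv, hw]
  | ha x y hx hy => simp only [map_add, hx, hy]

/-- For `y : C` and `z ⊗ m` in `C ⊗_R M`, the map `H ⊗_R (H ⊗_R A) → C ⊗_R (C ⊗_R M)`,
`g ⊗ (h ⊗ a) ↦ g y ⊗ (h z ⊗ a m)`. -/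
def orbit₂ (y z : C) (m : M) :
    BTensor (D.bialg.bimod H).r ((D.bialg.bimod H).tensorLeft (leftVia D.sA A)) →+
      D.Ind (D.Ind M) :=
  BTensor.map (AddMonoidHom.smul.flip y) (D.bialg.orbit D.sA z m)
    (fun r h => mul_smul (D.bialg.t r) h y)
    (fun r u => by
      rw [leftVia_ind]
      induction u using BTensor.ind with
      | h0 => simp only [map_zero]
      | ht h a =>
        change BTensor.tmul ((D.bialg.s r * h) • z) (a • m) =
          BTensor.tmul (D.bialg.s r • h • z) (a • m)
        rw [mul_smul]
      | ha u v hu hv => simp only [map_add, hu, hv])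

theorem orbit₂_assoc (y z : C) (m : M) (h : H) (a : A) :
    D.orbit₂ y z m (assoc _ _ _ (BTensor.tmul (D.bialg.coring.comul.toHom h) a)) =
      D.insInd (a • m) (D.bialg.act (D.bialg.s : R →+* H) (D.bialg.Δ h)
        (BTensor.tmul y z)) := by
  change _ = D.insInd (a • m) (D.bialg.orbit (D.bialg.s : R →+* H) y z
    (D.bialg.coring.comul.toHom h))
  generalize D.bialg.coring.comul.toHom h = w
  induction w using BTensor.ind with
  | h0 => simp only [BTensor.tmul, map_zero, AddMonoidHom.zero_apply]
  | ht p q => rfl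
  | ha v w hv hw =>
    simp only [BTensor.tmul, map_add, AddMonoidHom.add_apply] at hv hw ⊢
    rw [hv, hw]

theorem orbit₂_coact (y z : C) (m : M) (a : A) :
    D.orbit₂ y z m (BTensor.map (AddMonoidHom.id H) D.alg.comodule.coact (fun _ _ => rfl)
      D.alg.comodule.coact_left (D.alg.comodule.coact a)) =
      D.actInd a (D.insInd m (BTensor.tmul y z)) := by
  change _ = D.bialg.orbit D.sA y (BTensor.tmul z m) (D.alg.comodule.coact a)
  generalize D.alg.comodule.coact a = u
  induction u using BTensor.ind with
  | h0 => simp only [map_zero]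
  | ht h b => rfl
  | ha v w hv hw => simp only [map_add, hv, hw]

theorem coactInd_actInd (a : A) (x : D.Ind M) :
    D.coactInd (D.actInd a x) = D.actInd a (D.coactInd x) := by
  induction x using BTensor.ind with
  | h0 => simp only [map_zero]
  | ht c m =>
    obtain ⟨L, hL⟩ := BTensor.exists_list (D.alg.comodule.coact a)
    have claim : ∀ v : BTensor (D.bialg.bimod C).r (D.bialg.bimod C).l,
        (L.map fun p => D.insInd (p.2 • m)
          (D.bialg.act (D.bialg.s : R →+* H) (D.bialg.Δ p.1) v)).sum =
        D.actInd a (D.insInd m v) := by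
      intro v
      induction v using BTensor.ind with
      | h0 => simp only [map_zero, List.map_const', List.sum_replicate, smul_zero]
      | ht y z =>
        rw [← orbit₂_coact, D.alg.comodule.coassoc, hL]
        simp only [map_list_sum, List.map_map]
        congr 1
        refine List.map_congr_left fun p _ => ?_
        exact (D.orbit₂_assoc y z m p.1 p.2).symm
      | ha v w hv hw => simp only [map_add, List.sum_map_add, hv, hw]
    rw [coactInd_tmul, ← claim]
    change D.coactInd (D.bialg.orbit D.sA c m (D.alg.comodule.coact a)) = _
    rw [hL]
    simp only [map_list_sum, List.map_map]
    congr 1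
    refine List.map_congr_left fun p _ => ?_
    change D.coactInd (BTensor.tmul (p.1 • c) (p.2 • m)) = _
    rw [coactInd_tmul, D.coalg.comul_smul]
  | ha x y hx hy => simp only [map_add, hx, hy]

end Ind

/-- The Doi-Koppinen module `C ⊗_R M`. -/
def indObj (M : ModuleCat.{u} A) : DKModule D where
  carrier := D.Ind M
  comodule :=
    { coact := D.coactInd
      coact_left := D.coactInd_left
      coassoc := D.coactInd_coassoc
      counit_coact := D.coactInd_counit }
  compat := D.coactInd_actInd

theorem indMap_actInd {M N : Type*} [AddCommGroup M] [Module A M] [AddCommGroup N] [Module A N]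
    (f : M →ₗ[A] N) (a : A) (x : D.Ind M) :
    (indMap f (D.actInd a x) : D.Ind N) = D.actInd a (indMap f x : D.Ind N) := by
  induction x using BTensor.ind with
  | h0 => simp only [map_zero]
  | ht c m =>
    change indMap f (D.bialg.orbit D.sA c m (D.coactA a)) =
      D.bialg.orbit D.sA c (f m) (D.coactA a)
    generalize (D.coactA a : D.bialg.Tens D.sA H A) = u
    induction u using BTensor.ind with
    | h0 => simp only [map_zero]
    | ht h b =>
      change BTensor.tmul (h • c) (f (b • m)) = BTensor.tmul (h • c) (b • f m)
      rw [map_smul]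
    | ha u v hu hv => simp only [map_add, hu, hv]
  | ha x y hx hy => simp only [map_add, hx, hy]

/-- The `A`-linear map `C ⊗_R f : C ⊗_R M → C ⊗_R N`. -/
def indLin {M N : Type*} [AddCommGroup M] [Module A M] [AddCommGroup N] [Module A N]
    (f : M →ₗ[A] N) : D.Ind M →ₗ[A] D.Ind N where
  toFun := (indMap f : D.Ind M →+ D.Ind N)
  map_add' := map_add _
  map_smul' := D.indMap_actInd f

theorem coactInd_indMap {M N : Type*} [AddCommGroup M] [Module A M] [AddCommGroup N] [Module A N]
    (f : M →ₗ[A] N) (x : D.Ind M) :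
    D.coactInd (D.indLin f x) = (indMap (D.indLin f) (D.coactInd x) : D.Ind (D.Ind N)) := by
  change D.coactInd (indMap f x : D.Ind N) = _
  induction x using BTensor.ind with
  | h0 => simp only [map_zero]
  | ht c m =>
    change D.coactInd (BTensor.tmul c (f m)) = _
    rw [coactInd_tmul, coactInd_tmul]
    generalize D.coalg.coring.comul.toHom c = v
    induction v using BTensor.ind with
    | h0 => simp only [map_zero]
    | ht y z => rfl
    | ha v w hv hw => simp only [map_add, hv, hw]
  | ha x y hx hy => simp only [map_add, hx, hy]

/-- The induction functor `C ⊗_R -` from left `A`-modules to Doi-Koppinen modules. -/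
def induction : ModuleCat.{u} A ⥤ DKModule D where
  obj M := D.indObj M
  map f := ⟨D.indLin f.hom, D.coactInd_indMap f.hom⟩
  map_id _ := DKModule.Hom.ext (LinearMap.ext fun x => indMap_id x)
  map_comp f g := DKModule.Hom.ext (LinearMap.ext fun x => indMap_comp g.hom f.hom x)

/-! ### The maps occurring in the separability criteria -/

/-- The map `C ⊗_R A → A`, `c ⊗ a ↦ ε(c) · a = s(ε(c)) a`. -/
def normalise : D.Ind A →+ A :=
  contractLeft D.coalg.coring.counit.toHom (fun r => D.coalg.coring.counit.map_right (op r))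
    (leftVia D.sA A)

/-- The right `A`-action on `C ⊗_R A`: the map `c ⊗ b ↦ c ⊗ b a`. -/
def mulRightInd (a : A) : D.Ind A →+ D.Ind A :=
  BTensor.map (AddMonoidHom.id C) (AddMonoidHom.mulRight a) (fun _ _ => rfl)
    (fun r b => mul_assoc (D.sA r) b a)

/-- For `y : C`, the map `H ⊗_R A → C ⊗_R A`, `h ⊗ a ↦ h y ⊗ a`. -/
def leg (y : C) : D.bialg.Tens D.sA H A →+ D.Ind A :=
  BTensor.map (AddMonoidHom.smul.flip y) (AddMonoidHom.id A)
    (fun r h => mul_smul (D.bialg.t r) h y) (fun _ _ => rfl)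

theorem leg_add (y z : C) (u : D.bialg.Tens D.sA H A) :
    D.leg (y + z) u = D.leg y u + D.leg z u := by
  induction u using BTensor.ind with
  | h0 => simp only [map_zero, add_zero]
  | ht h a =>
    change BTensor.mk _ _ (h • (y + z)) a = BTensor.mk _ _ (h • y) a + BTensor.mk _ _ (h • z) a
    rw [smul_add, map_add]; rfl
  | ha u v hu hv => rw [map_add, map_add, map_add, hu, hv]; abel

theorem leg_coact_mul (y : C) (a : A) (r : R) :
    D.leg y (D.alg.comodule.coact (a * D.sA r)) =
      D.leg (D.bialg.s r • y) (D.alg.comodule.coact a) := by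
  rw [D.alg.coact_mul]
  change D.leg y (D.bialg.act D.sA (D.coactA a) (D.coactA (D.sA r))) = _
  rw [coactA_sA]
  change D.leg y (D.bialg.orbit D.sA (D.bialg.s r) (1 : A) (D.alg.comodule.coact a)) = _
  generalize D.alg.comodule.coact a = u
  induction u using BTensor.ind with
  | h0 => simp only [map_zero]
  | ht h b =>
    change BTensor.tmul ((h * D.bialg.s r) • y) (b * 1) = BTensor.tmul (h • D.bialg.s r • y) b
    rw [mul_smul, mul_one]
  | ha u v hu hv => simp only [map_add, hu, hv]

/-- Maps of `R`-bimodules `C ⊗_R C → A`. -/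
abbrev Pairing :=
  BimodHom ((D.bialg.bimod C).tensor (D.bialg.bimod C)) (ringBimod D.sA)

namespace Pairing

variable {D} (γ : D.Pairing)

/-- The biadditive map `(c, c') ↦ γ(c ⊗ c')`. -/
def app : C →+ C →+ A :=
  (BTensor.mk (D.bialg.bimod C).r (D.bialg.bimod C).l).compr₂ γ.toHom

theorem app_left (r : R) (c c' : C) : γ.app (D.bialg.s r • c) c' = D.sA r * γ.app c c' :=
  γ.map_left r (BTensor.tmul c c')

theorem app_right (r : R) (c c' : C) :
    γ.app c (D.bialg.t (op r) • c') = γ.app c c' * D.sA r :=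
  γ.map_right (op r) (BTensor.tmul c c')

theorem app_mid (r : R) (c c' : C) :
    γ.app (D.bialg.t (op r) • c) c' = γ.app c (D.bialg.s r • c') :=
  congrArg γ.toHom (BTensor.tmul_balanced (ρ := (D.bialg.bimod C).r) (l := (D.bialg.bimod C).l)
    c r c')

/-- For `c, c' : C`, the map `H ⊗_R A → A`, `h ⊗ a ↦ γ(c ⊗ h c') a`. -/
def twist₁ (c c' : C) : D.bialg.Tens D.sA H A →+ A :=
  BTensor.lift (AddMonoidHom.mul.comp ((γ.app c).comp (AddMonoidHom.smul.flip c')))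
    (fun h r a => by
      change γ.app c ((D.bialg.t (op r) * h) • c') * a = γ.app c (h • c') * (D.sA r * a)
      rw [mul_smul, app_right, mul_assoc])

/-- For `c, c' : C`, the map `H ⊗_R (H ⊗_R A) → A`, `g ⊗ (h ⊗ a) ↦ γ(g c ⊗ h c') a`. -/
def twist (c c' : C) :
    BTensor (D.bialg.bimod H).r ((D.bialg.bimod H).tensorLeft (leftVia D.sA A)) →+ A :=
  BTensor.lift (AddMonoidHom.mk' (fun g => γ.twist₁ (g • c) c')
      (fun g g' => BTensor.hom_ext fun h a => by
        change γ.app ((g + g') • c) (h • c') * a =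
          γ.app (g • c) (h • c') * a + γ.app (g' • c) (h • c') * a
        rw [add_smul, map_add, AddMonoidHom.add_apply, add_mul]))
    (fun g r u => by
      change γ.twist₁ ((D.bialg.t (op r) * g) • c) c' u = γ.twist₁ (g • c) c' _
      induction u using BTensor.ind with
      | h0 => simp only [map_zero]
      | ht h a =>
        change γ.app ((D.bialg.t (op r) * g) • c) (h • c') * a =
          γ.app (g • c) ((D.bialg.s r * h) • c') * a
        rw [mul_smul, mul_smul, app_mid]
      | ha u v hu hv => simp only [map_add, hu, hv])

/-- For `c' : C`, the map `C ⊗_R C → C ⊗_R A`, `x ⊗ y ↦ x ⊗ γ(y ⊗ c')`. -/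
def sideLeft (c' : C) : BTensor (D.bialg.bimod C).r (D.bialg.bimod C).l →+ D.Ind A :=
  BTensor.map (AddMonoidHom.id C) (γ.app.flip c') (fun _ _ => rfl) (fun r y => γ.app_left r y c')

/-- For `c : C`, the map `C ⊗_R C → C ⊗_R A`,
`x ⊗ y ↦ γ(c ⊗ x)₍₋₁₎ y ⊗ γ(c ⊗ x)₍₀₎`. -/
def sideRight (c : C) : BTensor (D.bialg.bimod C).r (D.bialg.bimod C).l →+ D.Ind A :=
  BTensor.lift (AddMonoidHom.mk' (fun x => AddMonoidHom.mk'
      (fun y => D.leg y (D.alg.comodule.coact (γ.app c x)))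
      (fun y z => D.leg_add y z _))
      (fun x x' => AddMonoidHom.ext fun y => by
        change D.leg y (D.alg.comodule.coact (γ.app c (x + x'))) =
          D.leg y (D.alg.comodule.coact (γ.app c x)) + D.leg y (D.alg.comodule.coact (γ.app c x'))
        rw [map_add, map_add, map_add]))
    (fun x r y => by
      change D.leg y (D.alg.comodule.coact (γ.app c (D.bialg.t (op r) • x))) =
        D.leg (D.bialg.s r • y) (D.alg.comodule.coact (γ.app c x))
      rw [app_right, leg_coact_mul])

end Pairing

/-- The iterated coaction `a ↦ a₍₋₂₎ ⊗ (a₍₋₁₎ ⊗ a₍₀₎)`. -/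
def coactTwo (a : A) :
    BTensor (D.bialg.bimod H).r ((D.bialg.bimod H).tensorLeft (leftVia D.sA A)) :=
  BTensor.map (AddMonoidHom.id H) D.alg.comodule.coact (fun _ _ => rfl)
    D.alg.comodule.coact_left (D.alg.comodule.coact a)

end Datum

end Modules

/-- A functor `F` is separable if the natural transformation `Hom(-, -) → Hom(F -, F -)` given by
`F` is a split monomorphism, i.e. has a natural left inverse. -/
def IsSeparable {𝒞 𝒟 : Type*} [Category 𝒞] [Category 𝒟] (F : 𝒞 ⥤ 𝒟) : Prop :=
  ∃ P : ∀ X Y : 𝒞, (F.obj X ⟶ F.obj Y) → (X ⟶ Y),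
    (∀ (X Y : 𝒞) (f : X ⟶ Y), P X Y (F.map f) = f) ∧
    ∀ (X' X Y Y' : 𝒞) (f : X' ⟶ X) (h : F.obj X ⟶ F.obj Y) (g : Y ⟶ Y'),
      P X' Y' (F.map f ≫ h ≫ F.map g) = f ≫ P X Y h ≫ g

end DK

/-! The forgetful functor F is left adjoint to G = C ⊗_R -. The unit η_M : M → C ⊗_R M is the
coaction, and the counit ε_N : C ⊗_R N → N applies the counit of C. By Rafael's argument, G is
separable exactly when ε has a natural section ζ, and F is separable exactly when η has a natural
retraction ω. A natural left inverse P of the functor yields ζ = P(η_{G-}), respectively ω =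
P(ε_{F-}). Conversely, ζ gives P(h) = ε ∘ F(h) ∘ ζ, and ω gives P(h) = ω ∘ G(h) ∘ η. It remains to
classify such ζ and ω.

For G: an element m of an A-module is the image of 1 under an A-linear map A → M, so ζ is determined
by e = ζ_A(1), with ζ_M(m) = ∑ cⁱ ⊗ aⁱ m. Naturality along right multiplications of A, together with
A-linearity, is the centrality of e, and ε ∘ ζ = id is its normalisation.

For F: naturality along A → N, 1 ↦ n, shows that the composite ε_N ∘ ω_{C ⊗ N} : C ⊗ C ⊗ N → N sends
c ⊗ c' ⊗ n to γ(c ⊗ c') n for a single pairing γ (`retractionCounit_tmul`). The three conditions on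
γ come from ω ∘ η = id, from A-linearity of ω, and from two evaluations of ω_{C ⊗ A}(c ⊗ c' ⊗ 1):
one by colinearity (`pairingOf_sideLeft`), one by naturality along the coaction
(`pairingOf_sideRight`). Conversely, γ defines ω_M(c ⊗ m) = γ(c ⊗ m₍₋₁₎) m₍₀₎; the same conditions
make it a retraction (`retract_coact`), A-linear (`retract_actInd`) and colinear (`coact_retract`).
-/

namespace DK

open BTensor DKModule

namespace Datum

variable {k R H : Type*} {A C : Type u} [CommRing k] [Ring R] [Algebra k R] [Ring H] [Algebra k H]
  [Ring A] [Algebra k A] [AddCommGroup C] [Module H C] (D : Datum k R H A C)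

/-! ### The adjunction between the forgetful functor and induction -/

section Adjunction

variable {M N : Type*} [AddCommGroup M] [Module A M] [AddCommGroup N] [Module A N]

/-- The additive map `C ⊗_R M → M`, `c ⊗ m ↦ ε(c) · m`. -/
def contractInd (M : Type*) [AddCommGroup M] [Module A M] : D.Ind M →+ M :=
  contractLeft D.coalg.coring.counit.toHom (fun r => D.coalg.coring.counit.map_right (op r))
    (leftVia D.sA M)

/-- The compatibility ε_C(h c) = ε_H(h s(ε_C(c))) trades the counit of C for that of H, so that the
counit axiom of the H-comodule A becomes applicable. -/
theorem contractInd_orbit (c : C) (m : M) (u : D.bialg.Tens D.sA H A) :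
    D.contractInd M (D.bialg.orbit D.sA c m u) =
      contractLeft D.bialg.coring.counit.toHom
        (fun r => D.bialg.coring.counit.map_right (op r)) (leftVia D.sA A)
        (D.bialg.orbit D.sA (D.bialg.s (D.coalg.coring.counit.toHom c)) (1 : A) u) • m := by
  induction u using BTensor.ind with
  | h0 => simp only [map_zero, zero_smul]
  | ht h b =>
    change D.sA (D.coalg.coring.counit.toHom (h • c)) • b • m =
      (D.sA (D.bialg.coring.counit.toHom (h * D.bialg.s (D.coalg.coring.counit.toHom c))) *
        (b * 1)) • m
    rw [D.coalg.counit_smul, mul_one, mul_smul]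
  | ha u v hu hv => simp only [map_add, add_smul, hu, hv]

theorem contractInd_actInd (a : A) (x : D.Ind M) :
    D.contractInd M (D.actInd a x) = a • D.contractInd M x := by
  induction x using BTensor.ind with
  | h0 => simp only [map_zero, smul_zero]
  | ht c m =>
    change D.contractInd M (D.bialg.orbit D.sA c m (D.alg.comodule.coact a)) =
      a • D.sA (D.coalg.coring.counit.toHom c) • m
    -- Since ρ(s_A(r)) = s_H(r) ⊗ 1, multiplicativity gives ρ(a s_A(r)) = a₍₋₁₎ s_H(r) ⊗ a₍₀₎. With
    -- r = ε_C(c), this is the element to which `contractInd_orbit` applies the counit of H.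
    have h := D.coactA_mul a (D.sA (D.coalg.coring.counit.toHom c))
    rw [coactA_sA] at h
    rw [contractInd_orbit, ← mul_smul,
      ← D.alg.comodule.counit_coact (a * D.sA (D.coalg.coring.counit.toHom c))]
    exact congrArg (fun u => contractLeft D.bialg.coring.counit.toHom
        (fun r => D.bialg.coring.counit.map_right (op r)) (leftVia D.sA A) u • m) h.symm
  | ha x y hx hy => simp only [map_add, smul_add, hx, hy]

/-- The counit of the adjunction: the `A`-linear map `C ⊗_R M → M`, `c ⊗ m ↦ ε(c) · m`. -/
def counitInd (M : Type*) [AddCommGroup M] [Module A M] : D.Ind M →ₗ[A] M where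
  toFun := D.contractInd M
  map_add' := map_add _
  map_smul' := D.contractInd_actInd

theorem counitInd_indMap (f : M →ₗ[A] N) (x : D.Ind M) :
    D.counitInd N (indMap f x : D.Ind N) = f (D.counitInd M x) := by
  induction x using BTensor.ind with
  | h0 => simp only [map_zero]
  | ht c m => exact (f.map_smul _ _).symm
  | ha x y hx hy => simp only [map_add, hx, hy]

theorem indMap_counitInd_insInd (m : M)
    (v : BTensor (D.bialg.bimod C).r (D.bialg.bimod C).l) :
    (indMap (D.counitInd M) (D.insInd m v) : D.Ind M) =
      BTensor.mk _ _ (contractRight D.coalg.coring.counit.toHom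
        D.coalg.coring.counit.map_left (D.bialg.bimod C).r v) m := by
  induction v using BTensor.ind with
  | h0 => simp only [map_zero, AddMonoidHom.zero_apply]
  | ht x y => exact (tmul_balanced x (D.coalg.coring.counit.toHom y) m).symm
  | ha v w hv hw => simp only [map_add, AddMonoidHom.add_apply, hv, hw]

/-- This triangle identity is the right counit axiom of C, tensored with M. It also recovers an
element of C ⊗_R M from its coaction. -/
theorem indMap_counitInd_coactInd (x : D.Ind M) :
    (indMap (D.counitInd M) (D.coactInd x) : D.Ind M) = x := by
  induction x using BTensor.ind with
  | h0 => simp only [map_zero]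
  | ht c m => rw [coactInd_tmul, indMap_counitInd_insInd, D.coalg.coring.comul_counit]
  | ha x y hx hy => simp only [map_add, hx, hy]

end Adjunction

/-! ### The unit, naturality and the triangle identities -/

/-- The `A`-linear coaction of a Doi-Koppinen module. -/
def coactLin (M : DKModule D) : M.carrier →ₗ[A] D.Ind M.carrier where
  toFun := M.comodule.coact
  map_add' := map_add _
  map_smul' := M.compat

theorem coactInd_coact (M : DKModule D) (m : M.carrier) :
    D.coactInd (M.comodule.coact m) =
      (indMap (D.coactLin M) (M.comodule.coact m) : D.Ind (D.Ind M.carrier)) := by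
  -- This is comodule coassociativity. The left R-action on C ⊗_R M in the coring axioms acts on C,
  -- while the one in `Ind` comes through A; by `leftVia_ind` they agree, and the identity map
  -- passes between the two tensor products.
  refine (congrArg (BTensor.map (ρ' := (D.bialg.bimod C).r)
    (l' := leftVia D.sA (D.Ind M.carrier)) (AddMonoidHom.id C)
    (AddMonoidHom.id (D.Ind M.carrier)) (fun _ _ => rfl)
    (fun r x => (D.leftVia_ind r x).symm)) (M.comodule.coassoc m)).symm.trans ?_
  generalize M.comodule.coact m = u
  induction u using BTensor.ind with
  | h0 => simp only [map_zero]
  | ht c m => rfl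
  | ha u v hu hv => simp only [map_add, hu, hv]

/-- The unit of the adjunction: the coaction of a Doi-Koppinen module `M`, as a morphism
`M ⟶ C ⊗_R M`. -/
def unitHom (M : DKModule D) : M ⟶ D.induction.obj (D.forget.obj M) :=
  ⟨D.coactLin M, D.coactInd_coact M⟩

/-- The counit of the adjunction, as a morphism of `A`-modules. -/
def counitHom (M : ModuleCat.{u} A) : D.forget.obj (D.induction.obj M) ⟶ M :=
  ModuleCat.ofHom (D.counitInd M)

theorem counitHom_naturality {M N : ModuleCat.{u} A} (f : M ⟶ N) :
    D.forget.map (D.induction.map f) ≫ D.counitHom N = D.counitHom M ≫ f :=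
  ModuleCat.hom_ext (LinearMap.ext fun x => D.counitInd_indMap f.hom x)

theorem unitHom_naturality {M N : DKModule D} (f : M ⟶ N) :
    f ≫ D.unitHom N = D.unitHom M ≫ D.induction.map (D.forget.map f) :=
  DKModule.Hom.ext (LinearMap.ext fun m => f.colin m)

theorem unitHom_induction_counitHom (M : ModuleCat.{u} A) :
    D.unitHom (D.induction.obj M) ≫ D.induction.map (D.counitHom M) = 𝟙 _ :=
  DKModule.Hom.ext (LinearMap.ext fun x => D.indMap_counitInd_coactInd x)

theorem forget_unitHom_counitHom (M : DKModule D) :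
    D.forget.map (D.unitHom M) ≫ D.counitHom (D.forget.obj M) = 𝟙 _ :=
  ModuleCat.hom_ext (LinearMap.ext fun m => M.comodule.counit_coact m)

/-! ### Separability of the induction functor -/

theorem indMap_toSpanSingleton (a : A) (x : D.Ind A) :
    (indMap (LinearMap.toSpanSingleton A A a) x : D.Ind A) = D.mulRightInd a x := by
  induction x using BTensor.ind with
  | h0 => simp only [map_zero]
  | ht c b => rfl
  | ha x y hx hy => simp only [map_add, hx, hy]

theorem indMap_toSpanSingleton_smul {M : Type*} [AddCommGroup M] [Module A M] (a : A) (m : M)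
    (x : D.Ind A) :
    (indMap (LinearMap.toSpanSingleton A M (a • m)) x : D.Ind M) =
      indMap (LinearMap.toSpanSingleton A M m) (D.mulRightInd a x) := by
  induction x using BTensor.ind with
  | h0 => simp only [map_zero]
  | ht c b =>
    change tmul c (b • a • m) = tmul c ((b * a) • m)
    rw [mul_smul]
  | ha x y hx hy => simp only [map_add, hx, hy]

theorem indMap_toSpanSingleton_add {M : Type*} [AddCommGroup M] [Module A M] (m n : M)
    (x : D.Ind A) :
    (indMap (LinearMap.toSpanSingleton A M (m + n)) x : D.Ind M) =
      indMap (LinearMap.toSpanSingleton A M m) x +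
        (indMap (LinearMap.toSpanSingleton A M n) x : D.Ind M) := by
  induction x using BTensor.ind with
  | h0 => simp only [map_zero, add_zero]
  | ht c b =>
    change BTensor.mk _ _ c (b • (m + n)) =
      BTensor.mk _ _ c (b • m) + BTensor.mk _ _ c (b • n)
    rw [smul_add, map_add]
  | ha x y hx hy => rw [map_add, map_add, map_add, hx, hy]; abel

theorem exists_normalised_of_isSeparable_induction (h : IsSeparable D.induction) :
    ∃ e : D.Ind A, D.normalise e = 1 ∧ ∀ a : A, D.actInd a e = D.mulRightInd a e := by
  obtain ⟨P, hP, hn⟩ := h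
  let X := ModuleCat.of A A
  let Y := D.forget.obj (D.induction.obj X)
  -- The component at A of the section that Rafael's argument attaches to P; its value at 1 is the
  -- required element.
  let ζ : X ⟶ Y := P X Y (D.unitHom (D.induction.obj X))
  refine ⟨ζ.hom (1 : A), ?_, fun a => ?_⟩
  · have h1 : ζ ≫ D.counitHom X = 𝟙 X := by
      -- Naturality of P moves ε inside P, where the triangle identity turns ε after η into an
      -- identity.
      have h2 := hn X X Y X (𝟙 X) (D.unitHom (D.induction.obj X)) (D.counitHom X)
      rw [D.unitHom_induction_counitHom, D.induction.map_id, Category.id_comp,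
        Category.id_comp] at h2
      rw [← h2, ← D.induction.map_id, hP]
    exact congrArg (fun f : X ⟶ X => f.hom (1 : A)) h1
  · let f : X ⟶ X := ModuleCat.ofHom (LinearMap.toSpanSingleton A A a)
    -- Both sides are values of P: naturality of η identifies precomposing η with G(f) and
    -- postcomposing it with GFG(f).
    have h1 : f ≫ ζ = ζ ≫ D.forget.map (D.induction.map f) := by
      have h2 := hn X X Y Y f (D.unitHom (D.induction.obj X)) (𝟙 Y)
      have h3 := hn X X Y Y (𝟙 X) (D.unitHom (D.induction.obj X))
        (D.forget.map (D.induction.map f))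
      rw [D.induction.map_id, Category.comp_id, Category.comp_id] at h2
      rw [D.induction.map_id, Category.id_comp, Category.id_comp, ← D.unitHom_naturality] at h3
      exact h2.symm.trans h3
    have h2 := (congrArg (fun f : X ⟶ Y => f.hom (1 : A)) h1).trans
      (D.indMap_toSpanSingleton a (ζ.hom (1 : A)))
    refine Eq.trans (ζ.hom.map_smul a (1 : A)).symm (Eq.trans (congrArg ζ.hom ?_) h2)
    -- The element a is both a • 1, which gives the left action on e by linearity of ζ, and the
    -- image of 1 under right multiplication by a.
    exact (mul_one a).trans (one_mul a).symm

/-! ### From a central element to a section of the counit -/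

variable {D} in
/-- The `A`-linear map `M → C ⊗_R M`, `m ↦ ∑ cᵢ ⊗ aᵢ m`, given by a central element
`∑ cᵢ ⊗ aᵢ` of `C ⊗_R A`. -/
def sectionLin {e : D.Ind A} (he : ∀ a : A, D.actInd a e = D.mulRightInd a e)
    (M : Type*) [AddCommGroup M] [Module A M] : M →ₗ[A] D.Ind M where
  toFun m := indMap (LinearMap.toSpanSingleton A M m) e
  map_add' m n := D.indMap_toSpanSingleton_add m n e
  map_smul' a m := by
    -- The scalar a first appears to the right of e; centrality turns it into the left action.
    rw [indMap_toSpanSingleton_smul, ← he]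
    exact D.indMap_actInd _ a e

theorem indMap_sectionLin {e : D.Ind A} (he : ∀ a : A, D.actInd a e = D.mulRightInd a e)
    {M N : Type*} [AddCommGroup M] [Module A M] [AddCommGroup N] [Module A N] (f : M →ₗ[A] N)
    (m : M) : (indMap f (sectionLin he M m) : D.Ind N) = sectionLin he N (f m) := by
  change (indMap f (indMap (LinearMap.toSpanSingleton A M m) e : D.Ind M) : D.Ind N) =
    indMap (LinearMap.toSpanSingleton A N (f m)) e
  rw [← indMap_comp, LinearMap.comp_toSpanSingleton]

theorem counitInd_sectionLin {e : D.Ind A} (he : ∀ a : A, D.actInd a e = D.mulRightInd a e)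
    (he1 : D.normalise e = 1) {M : Type*} [AddCommGroup M] [Module A M] (m : M) :
    D.counitInd M (sectionLin he M m) = m := by
  refine (D.counitInd_indMap (LinearMap.toSpanSingleton A M m) e).trans ?_
  change D.normalise e • m = m
  rw [he1, one_smul]

/-- The section of the counit given by a central element of `C ⊗_R A`. -/
def sectionHom {e : D.Ind A} (he : ∀ a : A, D.actInd a e = D.mulRightInd a e)
    (M : ModuleCat.{u} A) : M ⟶ D.forget.obj (D.induction.obj M) :=
  ModuleCat.ofHom (sectionLin he M)

theorem sectionHom_naturality {e : D.Ind A} (he : ∀ a : A, D.actInd a e = D.mulRightInd a e)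
    {M N : ModuleCat.{u} A} (f : M ⟶ N) :
    D.sectionHom he M ≫ D.forget.map (D.induction.map f) = f ≫ D.sectionHom he N :=
  ModuleCat.hom_ext (LinearMap.ext fun m => D.indMap_sectionLin he f.hom m)

theorem sectionHom_counitHom {e : D.Ind A} (he1 : D.normalise e = 1)
    (he : ∀ a : A, D.actInd a e = D.mulRightInd a e) (M : ModuleCat.{u} A) :
    D.sectionHom he M ≫ D.counitHom M = 𝟙 M :=
  ModuleCat.hom_ext (LinearMap.ext fun m => D.counitInd_sectionLin he he1 m)

theorem isSeparable_induction {e : D.Ind A} (he1 : D.normalise e = 1)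
    (he : ∀ a : A, D.actInd a e = D.mulRightInd a e) : IsSeparable D.induction := by
  -- Rafael's left inverse: h : G X → G Y is sent to ε_Y ∘ F(h) ∘ ζ_X.
  refine ⟨fun X Y h => D.sectionHom he X ≫ D.forget.map h ≫ D.counitHom Y,
    fun X Y f => ?_, fun X' X Y Y' f h g => ?_⟩
  · beta_reduce
    rw [counitHom_naturality, ← Category.assoc, sectionHom_counitHom D he1, Category.id_comp]
  · simp only [Functor.map_comp, Category.assoc, counitHom_naturality,
      reassoc_of% D.sectionHom_naturality he]

/-! ### Separability of the forgetful functor -/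

/-! ### From separability of the forgetful functor to a pairing -/

section ForgetOfSeparable

variable {P : ∀ X Y : DKModule D, (D.forget.obj X ⟶ D.forget.obj Y) → (X ⟶ Y)}

/-- The morphism `C ⊗_R M ⟶ M` of Doi-Koppinen modules obtained from the counit. -/
def retractionOf (P : ∀ X Y : DKModule D, (D.forget.obj X ⟶ D.forget.obj Y) → (X ⟶ Y))
    (M : DKModule D) : D.induction.obj (D.forget.obj M) ⟶ M :=
  P _ _ (D.counitHom (D.forget.obj M))

theorem unitHom_retractionOf (hP : ∀ (X Y : DKModule D) (f : X ⟶ Y), P X Y (D.forget.map f) = f)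
    (hn : ∀ (X' X Y Y' : DKModule D) (f : X' ⟶ X) (h : D.forget.obj X ⟶ D.forget.obj Y)
      (g : Y ⟶ Y'), P X' Y' (D.forget.map f ≫ h ≫ D.forget.map g) = f ≫ P X Y h ≫ g)
    (M : DKModule D) : D.unitHom M ≫ D.retractionOf P M = 𝟙 M := by
  have h := hn M _ M M (D.unitHom M) (D.counitHom (D.forget.obj M)) (𝟙 M)
  rw [D.forget.map_id, Category.comp_id, Category.comp_id, D.forget_unitHom_counitHom,
    ← D.forget.map_id, hP] at h
  exact h.symm

/-- Both composites are P of the same A-linear map, by naturality of the counit; naturality of P in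
each variable then separates them. -/
theorem retractionOf_naturality
    (hn : ∀ (X' X Y Y' : DKModule D) (f : X' ⟶ X) (h : D.forget.obj X ⟶ D.forget.obj Y)
      (g : Y ⟶ Y'), P X' Y' (D.forget.map f ≫ h ≫ D.forget.map g) = f ≫ P X Y h ≫ g)
    {M N : DKModule D} (f : M ⟶ N) :
    D.induction.map (D.forget.map f) ≫ D.retractionOf P N = D.retractionOf P M ≫ f := by
  have h1 := hn _ _ M N (𝟙 _) (D.counitHom (D.forget.obj M)) f
  have h2 := hn _ _ N N (D.induction.map (D.forget.map f)) (D.counitHom (D.forget.obj N)) (𝟙 N)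
  rw [D.forget.map_id, Category.id_comp, Category.id_comp] at h1
  rw [D.forget.map_id, Category.comp_id, Category.comp_id, D.counitHom_naturality] at h2
  exact h2.symm.trans h1

/-- The `A`-linear map `C ⊗_R (C ⊗_R N) ⟶ C ⊗_R N ⟶ N`. -/
def retractionCounit (P : ∀ X Y : DKModule D, (D.forget.obj X ⟶ D.forget.obj Y) → (X ⟶ Y))
    (N : ModuleCat.{u} A) : D.Ind (D.Ind N) →ₗ[A] N :=
  (D.counitInd N).comp (D.retractionOf P (D.induction.obj N)).lin

theorem retractionCounit_indMap
    (hn : ∀ (X' X Y Y' : DKModule D) (f : X' ⟶ X) (h : D.forget.obj X ⟶ D.forget.obj Y)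
      (g : Y ⟶ Y'), P X' Y' (D.forget.map f ≫ h ≫ D.forget.map g) = f ≫ P X Y h ≫ g)
    {M N : ModuleCat.{u} A} (f : M ⟶ N) (x : D.Ind (D.Ind M)) :
    D.retractionCounit P N (indMap (D.indLin f.hom) x : D.Ind (D.Ind N)) =
      f.hom (D.retractionCounit P M x) := by
  have h := congrArg (fun g => D.counitInd N (DKModule.Hom.lin g x))
    (D.retractionOf_naturality hn (D.induction.map f))
  exact h.trans (D.counitInd_indMap f.hom _)

/-- The pairing `c ⊗ c' ↦ (ε ⊗ A) ω(c ⊗ (c' ⊗ 1))`. -/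
def pairingOf
    (hn : ∀ (X' X Y Y' : DKModule D) (f : X' ⟶ X) (h : D.forget.obj X ⟶ D.forget.obj Y)
      (g : Y ⟶ Y'), P X' Y' (D.forget.map f ≫ h ≫ D.forget.map g) = f ≫ P X Y h ≫ g) :
    D.Pairing where
  toHom := (D.retractionCounit P (ModuleCat.of A A)).toAddMonoidHom.comp (D.insInd (1 : A))
  map_left r x := by
    change D.retractionCounit P (ModuleCat.of A A) (D.insInd (1 : A) _) =
      D.sA r • D.retractionCounit P (ModuleCat.of A A) (D.insInd (1 : A) x)
    rw [insInd_left, ← leftVia_ind]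
    exact (D.retractionCounit P (ModuleCat.of A A)).map_smul (D.sA r) _
  map_right r x := by
    -- Right multiplication by s_A(r) is a left A-linear endomorphism of A, so right R-linearity is
    -- an instance of naturality in N.
    have h := D.retractionCounit_indMap hn
      (ModuleCat.ofHom (LinearMap.toSpanSingleton A A (D.sA r.unop)) :
        ModuleCat.of A A ⟶ ModuleCat.of A A) (D.insInd (1 : A) x)
    refine Eq.trans (congrArg (D.retractionCounit P (ModuleCat.of A A)) ?_) h
    clear h
    induction x using BTensor.ind with
    | h0 => simp only [map_zero]
    | ht c c' =>
      change tmul c (tmul (D.bialg.t r • c') (1 : A)) =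
        tmul c (tmul c' ((1 : A) * D.sA r.unop))
      refine congrArg (tmul c) ((tmul_balanced c' r.unop (1 : A)).trans ?_)
      change tmul c' (D.sA r.unop * (1 : A)) = _
      rw [mul_one, one_mul]
    | ha x y hx hy => simp only [map_add, hx, hy]

variable (hn : ∀ (X' X Y Y' : DKModule D) (f : X' ⟶ X) (h : D.forget.obj X ⟶ D.forget.obj Y)
      (g : Y ⟶ Y'), P X' Y' (D.forget.map f ≫ h ≫ D.forget.map g) = f ≫ P X Y h ≫ g)

/-- Naturality along A → N, 1 ↦ n, reduces every N to A. Thus a single pairing governs all the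
modules C ⊗_R N. -/
theorem retractionCounit_tmul (N : ModuleCat.{u} A) (c c' : C) (n : N) :
    D.retractionCounit P N (tmul c (tmul c' n)) = (D.pairingOf hn).app c c' • n := by
  have h := D.retractionCounit_indMap hn
    (ModuleCat.ofHom (LinearMap.toSpanSingleton A N n) : ModuleCat.of A A ⟶ N)
    (tmul c (tmul c' (1 : A)))
  refine Eq.trans (congrArg (D.retractionCounit P N) ?_) h
  change tmul c (tmul c' n) = tmul c (tmul c' ((1 : A) • n))
  rw [one_smul]

/-- Apply the counit to ω ∘ η = id on C ⊗_R A, evaluated at c ⊗ 1. -/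
theorem pairingOf_comul
    (hP : ∀ (X Y : DKModule D) (f : X ⟶ Y), P X Y (D.forget.map f) = f) (c : C) :
    (D.pairingOf hn).toHom (D.coalg.coring.comul.toHom c) =
      D.sA (D.coalg.coring.counit.toHom c) * 1 := by
  change D.retractionCounit P (ModuleCat.of A A) (D.insInd (1 : A) _) = _
  rw [← coactInd_tmul]
  exact congrArg (fun g => D.counitInd A (DKModule.Hom.lin g (tmul c (1 : A))))
    (D.unitHom_retractionOf hP hn (D.induction.obj (ModuleCat.of A A)))

/-- This is the A-linearity of ε ∘ ω: by `orbit₂_coact`, the action of a on C ⊗_R (C ⊗_R A) runs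
through its iterated coaction. -/
theorem pairingOf_twist (a : A) (c c' : C) :
    (D.pairingOf hn).twist c c' (D.coactTwo a) = a * (D.pairingOf hn).app c c' := by
  refine Eq.trans ?_ ((D.retractionCounit P (ModuleCat.of A A)).map_smul a
    (D.insInd (1 : A) (tmul c c')))
  change _ = D.retractionCounit P (ModuleCat.of A A) (D.actInd a (D.insInd (1 : A) (tmul c c')))
  rw [← orbit₂_coact]
  change _ = D.retractionCounit P (ModuleCat.of A A) (D.orbit₂ c c' (1 : A) (D.coactTwo a))
  generalize D.coactTwo a = u
  induction u using BTensor.ind with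
  | h0 => simp only [map_zero]
  | ht g v =>
    change (D.pairingOf hn).twist₁ (g • c) c' v = D.retractionCounit P (ModuleCat.of A A)
      (tmul (g • c) (D.bialg.orbit D.sA c' (1 : A) v))
    induction v using BTensor.ind with
    | h0 => simp only [tmul, map_zero]
    | ht h b =>
      refine Eq.trans ?_ (D.retractionCounit_tmul hn (ModuleCat.of A A) _ _ _).symm
      change _ * b = _ * (b * 1)
      rw [mul_one]; rfl
    | ha v w hv hw => simp only [tmul, map_add] at hv hw ⊢; rw [hv, hw]
  | ha u v hu hv => simp only [map_add, hu, hv]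

/-- By colinearity, the coaction of ω(c ⊗ c' ⊗ 1) is c₍₁₎ ⊗ ω(c₍₂₎ ⊗ c' ⊗ 1). Applying C ⊗ ε undoes
the coaction on one side and produces γ on the other. -/
theorem pairingOf_sideLeft (c c' : C) :
    (D.pairingOf hn).sideLeft c' (D.coalg.coring.comul.toHom c) =
      (D.retractionOf P (D.induction.obj (ModuleCat.of A A))).lin (tmul c (tmul c' (1 : A))) := by
  let ω := D.retractionOf P (D.induction.obj (ModuleCat.of A A))
  let ωl : D.Ind (D.Ind A) →ₗ[A] D.Ind A := ω.lin
  have h1 := ω.colin (tmul c (tmul c' (1 : A)))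
  have h2 := D.indMap_counitInd_coactInd (ω.lin (tmul c (tmul c' (1 : A))))
  refine Eq.trans ?_ ((congrArg (indMap (D.counitInd A)) h1).symm.trans h2)
  refine Eq.trans ?_ (congrArg (fun y => (indMap (D.counitInd A) (indMap ωl y : D.Ind (D.Ind A)) :
    D.Ind A)) (D.coactInd_tmul c (tmul c' (1 : A)))).symm
  generalize D.coalg.coring.comul.toHom c = v
  induction v using BTensor.ind with
  | h0 => simp only [map_zero]
  | ht x y => rfl
  | ha v w hv hw => simp only [map_add, hv, hw]

/-- Naturality of ω along the coaction of X = C ⊗_R A, followed by the counit, expresses ω_X(c ⊗ c'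
⊗ 1) through ε ∘ ω at N = C ⊗_R A, applied to c ⊗ Δ(c') ⊗ 1. There `retractionCounit_tmul` yields
γ(c ⊗ c'₍₁₎) acting on c'₍₂₎ ⊗ 1, and the diagonal A-action brings in the coaction of γ(c ⊗ c'₍₁₎).
-/
theorem pairingOf_sideRight (c c' : C) :
    (D.pairingOf hn).sideRight c (D.coalg.coring.comul.toHom c') =
      (D.retractionOf P (D.induction.obj (ModuleCat.of A A))).lin (tmul c (tmul c' (1 : A))) := by
  let X := D.induction.obj (ModuleCat.of A A)
  have h1 := congrArg (fun g => D.counitInd (D.Ind A)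
    (DKModule.Hom.lin g (tmul c (tmul c' (1 : A))))) (D.retractionOf_naturality hn (D.unitHom X))
  refine Eq.trans ?_ (h1.trans (X.comodule.counit_coact _))
  change _ = D.retractionCounit P (ModuleCat.of A (D.Ind A))
    (tmul c (D.coactInd (tmul c' (1 : A))))
  rw [coactInd_tmul]
  generalize D.coalg.coring.comul.toHom c' = v
  induction v using BTensor.ind with
  | h0 => simp only [tmul, map_zero]
  | ht x y =>
    refine Eq.trans ?_ (D.retractionCounit_tmul hn (ModuleCat.of A (D.Ind A)) c x
      (tmul y (1 : A))).symm
    change D.leg y (D.alg.comodule.coact ((D.pairingOf hn).app c x)) =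
      D.bialg.orbit D.sA y (1 : A) (D.alg.comodule.coact ((D.pairingOf hn).app c x))
    generalize D.alg.comodule.coact ((D.pairingOf hn).app c x) = u
    induction u using BTensor.ind with
    | h0 => simp only [map_zero]
    | ht h b =>
      change tmul (h • y) b = tmul (h • y) (b * 1)
      rw [mul_one]
    | ha u v hu hv => simp only [map_add, hu, hv]
  | ha v w hv hw => simp only [tmul, map_add] at hv hw ⊢; rw [hv, hw]

end ForgetOfSeparable

/-! ### From a pairing to a natural retraction of the unit -/

namespace Pairing

variable {D} (γ : D.Pairing)

section

variable {M : Type*} [AddCommGroup M] [Module A M]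

/-- For `c : C`, the map `C ⊗_R M → M`, `c' ⊗ m ↦ γ(c ⊗ c') m`. -/
def eval (M : Type*) [AddCommGroup M] [Module A M] (c : C) : D.Ind M →+ M :=
  BTensor.lift (AddMonoidHom.smul.comp (γ.app c)) (fun c' r m => by
    change γ.app c (D.bialg.t (op r) • c') • m = γ.app c c' • D.sA r • m
    rw [app_right, mul_smul])

theorem eval_tmul (c c' : C) (m : M) : γ.eval M c (tmul c' m) = γ.app c c' • m := rfl

theorem eval_add (c d : C) (x : D.Ind M) :
    γ.eval M (c + d) x = γ.eval M c x + γ.eval M d x := by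
  induction x using BTensor.ind with
  | h0 => simp only [map_zero, add_zero]
  | ht c' m =>
    change γ.app (c + d) c' • m = γ.app c c' • m + γ.app d c' • m
    rw [map_add, AddMonoidHom.add_apply, add_smul]
  | ha x y hx hy => rw [map_add, map_add, map_add, hx, hy]; abel

theorem eval_t (r : R) (c : C) (x : D.Ind M) :
    γ.eval M (D.bialg.t (op r) • c) x =
      γ.eval M c ((D.bialg.bimod C).tensorLeft (leftVia D.sA M) r x) := by
  induction x using BTensor.ind with
  | h0 => simp only [map_zero]
  | ht c' m =>
    change γ.app (D.bialg.t (op r) • c) c' • m = γ.app c (D.bialg.s r • c') • m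
    rw [app_mid]
  | ha x y hx hy => simp only [map_add, hx, hy]

theorem eval_s (r : R) (c : C) (x : D.Ind M) :
    γ.eval M (D.bialg.s r • c) x = D.sA r • γ.eval M c x := by
  induction x using BTensor.ind with
  | h0 => simp only [map_zero, smul_zero]
  | ht c' m =>
    change γ.app (D.bialg.s r • c) c' • m = D.sA r • γ.app c c' • m
    rw [app_left, mul_smul]
  | ha x y hx hy => simp only [map_add, smul_add, hx, hy]

theorem eval_indMap {N : Type*} [AddCommGroup N] [Module A N] (f : M →ₗ[A] N) (c : C)
    (x : D.Ind M) : γ.eval N c (indMap f x) = f (γ.eval M c x) := by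
  induction x using BTensor.ind with
  | h0 => simp only [map_zero]
  | ht c' m => exact (f.map_smul _ _).symm
  | ha x y hx hy => simp only [map_add, hx, hy]

theorem eval_orbit (c c' : C) (m : M) (u : D.bialg.Tens D.sA H A) :
    γ.eval M c (D.bialg.orbit D.sA c' m u) = γ.twist₁ c c' u • m := by
  induction u using BTensor.ind with
  | h0 => simp only [map_zero, zero_smul]
  | ht h b =>
    change γ.app c (h • c') • b • m = (γ.app c (h • c') * b) • m
    rw [mul_smul]
  | ha u v hu hv => simp only [map_add, add_smul, hu, hv]

end

/-- The map `C ⊗_R M → M`, `c ⊗ m ↦ γ(c ⊗ m₍₋₁₎) m₍₀₎`, for a Doi-Koppinen module `M`. -/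
def retract (M : DKModule D) : D.Ind M.carrier →+ M.carrier :=
  BTensor.lift (AddMonoidHom.mk' (fun c => (γ.eval M.carrier c).comp M.comodule.coact)
      (fun c d => AddMonoidHom.ext fun m => γ.eval_add c d _))
    (fun c r m => by
      change γ.eval M.carrier (D.bialg.t (op r) • c) (M.comodule.coact m) =
        γ.eval M.carrier c (M.comodule.coact (leftVia D.sA M.carrier r m))
      rw [M.comodule.coact_left, eval_t])

theorem retract_tmul (M : DKModule D) (c : C) (m : M.carrier) :
    γ.retract M (tmul c m) = γ.eval M.carrier c (M.comodule.coact m) := rfl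

theorem retract_coact
    (hγ : ∀ c : C, γ.toHom (D.coalg.coring.comul.toHom c) =
      D.sA (D.coalg.coring.counit.toHom c) * 1)
    (M : DKModule D) (m : M.carrier) : γ.retract M (M.comodule.coact m) = m := by
  -- The map c ⊗ (c' ⊗ m) ↦ γ(c ⊗ c') m. Applied to coassociativity, one side becomes the retraction
  -- of the coaction; on the other, γ meets Δ and collapses to the counit.
  let φ : BTensor (D.bialg.bimod C).r ((D.bialg.bimod C).tensorLeft (leftVia D.sA M.carrier)) →+
      M.carrier :=
    BTensor.lift (AddMonoidHom.mk' (fun c => γ.eval M.carrier c)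
      (fun c d => AddMonoidHom.ext fun x => γ.eval_add c d x)) (fun c r x => γ.eval_t r c x)
  refine Eq.trans ?_ ((congrArg φ (M.comodule.coassoc m)).trans
    (Eq.trans ?_ (M.comodule.counit_coact m)))
  · generalize M.comodule.coact m = u
    induction u using BTensor.ind with
    | h0 => simp only [map_zero]
    | ht c m => rfl
    | ha u v hu hv => simp only [map_add, hu, hv]
  · generalize M.comodule.coact m = u
    induction u using BTensor.ind with
    | h0 => simp only [map_zero]
    | ht c m =>
      refine Eq.trans ?_ (congrArg (· • m) ((hγ c).trans (mul_one _)))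
      change φ (assoc _ _ _ (BTensor.mk _ _ (D.coalg.coring.comul.toHom c) m)) = γ.toHom _ • m
      generalize D.coalg.coring.comul.toHom c = v
      induction v using BTensor.ind with
      | h0 => simp only [map_zero, AddMonoidHom.zero_apply, zero_smul]
      | ht x y => rfl
      | ha v w hv hw => simp only [map_add, AddMonoidHom.add_apply, add_smul, hv, hw]
    | ha u v hu hv => simp only [map_add, hu, hv]

/-- Writing ρ(a) as the explicit sum `L`, the action of each second leg applies ρ once more, so the
iterated coaction of a appears and the twist condition applies. -/
theorem eval_actInd {M : Type*} [AddCommGroup M] [Module A M]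
    (hγ : ∀ (a : A) (c c' : C), γ.twist c c' (D.coactTwo a) = a * γ.app c c')
    (a : A) (c : C) (x : D.Ind M) {L : List (H × A)}
    (hL : D.alg.comodule.coact a =
      (L.map fun p => (tmul p.1 p.2 : D.bialg.Tens D.sA H A)).sum) :
    (L.map fun p => γ.eval M (p.1 • c) (D.actInd p.2 x)).sum = a • γ.eval M c x := by
  induction x using BTensor.ind with
  | h0 => simp only [map_zero, List.map_const', List.sum_replicate, smul_zero]
  | ht c' m =>
    rw [eval_tmul, ← mul_smul, ← hγ]
    change _ = γ.twist c c' (BTensor.map (AddMonoidHom.id H) D.alg.comodule.coact _ _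
      (D.alg.comodule.coact a)) • m
    rw [hL]
    simp only [map_list_sum, List.map_map, List.sum_smul]
    congr 1
    refine List.map_congr_left fun p _ => ?_
    exact γ.eval_orbit _ _ _ _
  | ha x y hx hy => simp only [map_add, smul_add, List.sum_map_add, hx, hy]

theorem retract_actInd
    (hγ : ∀ (a : A) (c c' : C), γ.twist c c' (D.coactTwo a) = a * γ.app c c')
    (M : DKModule D) (a : A) (x : D.Ind M.carrier) :
    γ.retract M (D.actInd a x) = a • γ.retract M x := by
  induction x using BTensor.ind with
  | h0 => simp only [map_zero, smul_zero]
  | ht c m =>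
    obtain ⟨L, hL⟩ := BTensor.exists_list (D.alg.comodule.coact a)
    rw [retract_tmul, ← γ.eval_actInd hγ a c _ hL]
    change γ.retract M (D.bialg.orbit D.sA c m (D.alg.comodule.coact a)) = _
    rw [hL]
    simp only [map_list_sum, List.map_map]
    congr 1
    refine List.map_congr_left fun p _ => ?_
    change γ.eval M.carrier (p.1 • c) (M.comodule.coact (p.2 • m)) = _
    rw [M.compat]
  | ha x y hx hy => simp only [map_add, smul_add, hx, hy]

/-- The `A`-linear map `C ⊗_R M → M`, `c ⊗ m ↦ γ(c ⊗ m₍₋₁₎) m₍₀₎`. -/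
def retractLin (hγ : ∀ (a : A) (c c' : C), γ.twist c c' (D.coactTwo a) = a * γ.app c c')
    (M : DKModule D) : D.Ind M.carrier →ₗ[A] M.carrier where
  toFun := γ.retract M
  map_add' := map_add _
  map_smul' := γ.retract_actInd hγ M

/-! ### Colinearity and naturality of the retraction -/

/-- For `x = ∑ cᵢ ⊗ mᵢ` in `C ⊗_R M`, the map `C ⊗_R C → C ⊗_R M`,
`y ⊗ z ↦ ∑ y ⊗ γ(z ⊗ cᵢ) mᵢ`. -/
def evalRight {M : Type*} [AddCommGroup M] [Module A M] (x : D.Ind M) :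
    BTensor (D.bialg.bimod C).r (D.bialg.bimod C).l →+ D.Ind M :=
  BTensor.map (AddMonoidHom.id C)
    (AddMonoidHom.mk' (fun c => γ.eval M c x) (fun c d => γ.eval_add c d x)) (fun _ _ => rfl)
    (fun r c => γ.eval_s r c x)

theorem evalRight_add {M : Type*} [AddCommGroup M] [Module A M] (x y : D.Ind M)
    (v : BTensor (D.bialg.bimod C).r (D.bialg.bimod C).l) :
    γ.evalRight (x + y) v = γ.evalRight x v + γ.evalRight y v := by
  induction v using BTensor.ind with
  | h0 => simp only [map_zero, add_zero]
  | ht c d =>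
    change BTensor.mk _ _ c (γ.eval M d (x + y)) =
      BTensor.mk _ _ c (γ.eval M d x) + BTensor.mk _ _ c (γ.eval M d y)
    rw [map_add, map_add]
  | ha v w hv hw => rw [map_add, map_add, map_add, hv, hw]; abel

theorem evalRight_tmul {M : Type*} [AddCommGroup M] [Module A M] (c' : C) (m : M)
    (v : BTensor (D.bialg.bimod C).r (D.bialg.bimod C).l) :
    γ.evalRight (tmul c' m) v =
      indMap (LinearMap.toSpanSingleton A M m) (γ.sideLeft c' v) := by
  induction v using BTensor.ind with
  | h0 => simp only [map_zero]
  | ht x y => rfl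
  | ha v w hv hw => simp only [map_add, hv, hw]

theorem eval_insInd {M : Type*} [AddCommGroup M] [Module A M] (c : C) (m : M)
    (v : BTensor (D.bialg.bimod C).r (D.bialg.bimod C).l) :
    γ.eval (D.Ind M) c (D.insInd m v) =
      indMap (LinearMap.toSpanSingleton A M m) (γ.sideRight c v) := by
  induction v using BTensor.ind with
  | h0 => simp only [map_zero]
  | ht x y =>
    change D.bialg.orbit D.sA y m (D.alg.comodule.coact (γ.app c x)) =
      indMap (LinearMap.toSpanSingleton A M m) (D.leg y (D.alg.comodule.coact (γ.app c x)))
    generalize D.alg.comodule.coact (γ.app c x) = u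
    induction u using BTensor.ind with
    | h0 => simp only [map_zero]
    | ht h b => rfl
    | ha u v hu hv => simp only [map_add, hu, hv]
  | ha v w hv hw => simp only [map_add, hv, hw]

/-- The third condition on γ, transported from A to M: on c' ⊗ m, both sides are images under A → M,
1 ↦ m, of the two sides of that condition. -/
theorem eval_coactInd {M : Type*} [AddCommGroup M] [Module A M]
    (hγ : ∀ c c' : C, γ.sideLeft c' (D.coalg.coring.comul.toHom c) =
      γ.sideRight c (D.coalg.coring.comul.toHom c')) (c : C) (x : D.Ind M) :
    γ.eval (D.Ind M) c (D.coactInd x) = γ.evalRight x (D.coalg.coring.comul.toHom c) := by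
  induction x using BTensor.ind with
  | h0 =>
    rw [map_zero, map_zero]
    -- `evalRight` is not bundled as additive in `x`, so its vanishing at 0 is read off from 0 + 0 =
    -- 0.
    have h := γ.evalRight_add (0 : D.Ind M) 0 (D.coalg.coring.comul.toHom c)
    rw [add_zero] at h
    exact (add_eq_left.mp h.symm).symm
  | ht c' m => rw [coactInd_tmul, eval_insInd, evalRight_tmul, hγ]
  | ha x y hx hy => rw [map_add, map_add, hx, hy, evalRight_add]

theorem coact_retract (hγ : ∀ c c' : C, γ.sideLeft c' (D.coalg.coring.comul.toHom c) =
      γ.sideRight c (D.coalg.coring.comul.toHom c'))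
    (hγ' : ∀ (a : A) (c c' : C), γ.twist c c' (D.coactTwo a) = a * γ.app c c')
    (M : DKModule D) (x : D.Ind M.carrier) :
    M.comodule.coact (γ.retract M x) =
      (indMap (γ.retractLin hγ' M) (D.coactInd x) : D.Ind M.carrier) := by
  induction x using BTensor.ind with
  | h0 => simp only [map_zero]
  | ht c m =>
    -- The coaction of M is A-linear, so it passes through γ(c ⊗ m₍₋₁₎) to m₍₀₎; coassociativity
    -- then makes it Δ on m₍₋₁₎, and the third condition moves that Δ onto c.
    refine (γ.eval_indMap (D.coactLin M) c (M.comodule.coact m)).symm.trans ?_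
    rw [← coactInd_coact, γ.eval_coactInd hγ, coactInd_tmul]
    generalize D.coalg.coring.comul.toHom c = v
    induction v using BTensor.ind with
    | h0 => simp only [map_zero]
    | ht x y => rfl
    | ha v w hv hw => simp only [map_add, hv, hw]
  | ha x y hx hy => simp only [map_add, hx, hy]

/-- The morphism `C ⊗_R M ⟶ M`, `c ⊗ m ↦ γ(c ⊗ m₍₋₁₎) m₍₀₎`, of Doi-Koppinen modules. -/
def retractHom (hγ : ∀ c c' : C, γ.sideLeft c' (D.coalg.coring.comul.toHom c) =
      γ.sideRight c (D.coalg.coring.comul.toHom c'))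
    (hγ' : ∀ (a : A) (c c' : C), γ.twist c c' (D.coactTwo a) = a * γ.app c c')
    (M : DKModule D) : D.induction.obj (D.forget.obj M) ⟶ M :=
  ⟨γ.retractLin hγ' M, γ.coact_retract hγ hγ' M⟩

theorem retractHom_naturality (hγ : ∀ c c' : C, γ.sideLeft c' (D.coalg.coring.comul.toHom c) =
      γ.sideRight c (D.coalg.coring.comul.toHom c'))
    (hγ' : ∀ (a : A) (c c' : C), γ.twist c c' (D.coactTwo a) = a * γ.app c c')
    {M N : DKModule D} (f : M ⟶ N) :
    D.induction.map (D.forget.map f) ≫ γ.retractHom hγ hγ' N =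
      γ.retractHom hγ hγ' M ≫ f := by
  refine DKModule.Hom.ext (LinearMap.ext fun x => ?_)
  change γ.retract N (indMap f.lin x : D.Ind N.carrier) = f.lin (γ.retract M x)
  change D.Ind M.carrier at x
  induction x using BTensor.ind with
  | h0 => simp only [map_zero]
  | ht c m =>
    change γ.eval N.carrier c (N.comodule.coact (f.lin m)) =
      f.lin (γ.eval M.carrier c (M.comodule.coact m))
    rw [f.colin, eval_indMap]
  | ha x y hx hy => simp only [map_add, hx, hy]

theorem isSeparable_forget
    (hγ₁ : ∀ c : C, γ.toHom (D.coalg.coring.comul.toHom c) =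
      D.sA (D.coalg.coring.counit.toHom c) * 1)
    (hγ₂ : ∀ (a : A) (c c' : C), γ.twist c c' (D.coactTwo a) = a * γ.app c c')
    (hγ₃ : ∀ c c' : C, γ.sideLeft c' (D.coalg.coring.comul.toHom c) =
      γ.sideRight c (D.coalg.coring.comul.toHom c')) : IsSeparable D.forget := by
  have h₁ : ∀ M : DKModule D, D.unitHom M ≫ γ.retractHom hγ₃ hγ₂ M = 𝟙 M := fun M =>
    DKModule.Hom.ext (LinearMap.ext fun m => γ.retract_coact hγ₁ M m)
  -- Rafael's left inverse: h : F X → F Y is sent to ω_Y ∘ G(h) ∘ η_X.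
  refine ⟨fun X Y h => D.unitHom X ≫ D.induction.map h ≫ γ.retractHom hγ₃ hγ₂ Y,
    fun X Y f => ?_, fun X' X Y Y' f h g => ?_⟩
  · beta_reduce
    rw [retractHom_naturality, ← Category.assoc, h₁, Category.id_comp]
  · simp only [Functor.map_comp, Category.assoc, retractHom_naturality,
      reassoc_of% D.unitHom_naturality f]

end Pairing

end Datum

end DK

theorem mainTheorem5 {k R H : Type*} {A C : Type u}
    [CommRing k] [Ring R] [Algebra k R] [Ring H] [Algebra k H] [Ring A] [Algebra k A]
    [AddCommGroup C] [Module H C] (D : DK.Datum k R H A C) :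
    (DK.IsSeparable D.induction ↔
      ∃ e : D.Ind A, D.normalise e = 1 ∧ ∀ a : A, D.actInd a e = D.mulRightInd a e) ∧
    (DK.IsSeparable D.forget ↔
      ∃ γ : D.Pairing,
        (∀ c : C, γ.toHom (D.coalg.coring.comul.toHom c) =
          D.sA (D.coalg.coring.counit.toHom c) * 1) ∧
        (∀ (a : A) (c c' : C), γ.twist c c' (D.coactTwo a) = a * γ.app c c') ∧
        (∀ c c' : C, γ.sideLeft c' (D.coalg.coring.comul.toHom c) =
          γ.sideRight c (D.coalg.coring.comul.toHom c'))) := by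
  refine ⟨⟨D.exists_normalised_of_isSeparable_induction,
    fun ⟨_, he1, he⟩ => D.isSeparable_induction he1 he⟩, ?_,
    fun ⟨γ, h₁, h₂, h₃⟩ => γ.isSeparable_forget h₁ h₂ h₃⟩
  rintro ⟨P, hP, hn⟩
  exact ⟨D.pairingOf hn, D.pairingOf_comul hn hP, D.pairingOf_twist hn,
    fun c c' => (D.pairingOf_sideLeft hn c c').trans (D.pairingOf_sideRight hn c c').symm⟩
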